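/- A fuzzy graph $G=(V,E^+,E^0)$ is a finite vertex set $V$ with disjoint sets $E^+$ of real edges and $E^0$ of fuzzy edges; the remaining pairs of distinct vertices are the nonedges. An instance of Correlation Clustering is a triple $(G,\omega,k)$ with a weight function $\omega:\binom V2\to\mathbb Z_{\ge 0}$ that is $0$ exactly on the fuzzy edges and an integer $k\ge 0$; it is a yes-instance if $V$ has a partition into clusters such that the total weight of the real edges between different clusters plus the total weight of the nonedges inside clusters is at most $k$. The fuzzy closure of $G$ is the smallest $c\ge 0$ such that any two distinct vertices that are not joined by a fuzzy edge have less than $c$ common neighbors in the graph $(V,E^0)$. Theorem. Correlation Clustering parameterized by $k+c$, where $c$ is the fuzzy closure of the input, has a polynomial kernel with at most $30k^2c^2$ vertices. That is, there is an algorithm that, given an instance $(G,\omega,k)$ with fuzzy closure $c$, computes in time polynomial in the (binary) encoding length of $(G,\omega,k)$ an instance $(G',\omega',k')$ with fuzzy closure $c'$ such that $(G',\omega',k')$ is a yes-instance if and only if $(G,\omega,k)$ is one; the encoding length of $(G',\omega',k')$ plus $k'+c'$ is bounded by a polynomial in $k+c$; $k'\le k$ and $c'\le c$; and $G'$ has at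 most $30k^2c^2$ vertices if $k\ge 1$, and at most $3$ vertices if $k=0$. -/

import Mathlib

namespace CorrelationClustering

/-! ## Fuzzy graphs and the fuzzy closure -/

/-- A fuzzy graph: real edges and fuzzy edges on a common vertex set, no pair being both. -/
structure FuzzyGraph (V : Type*) where
  /-- the graph of the real edges -/
  real : SimpleGraph V
  /-- the graph of the fuzzy edges -/
  fuzzy : SimpleGraph V
  disjoint : Disjoint real fuzzy

/-- The graph of the nonedges: the pairs that are neither a real nor a fuzzy edge. -/
def FuzzyGraph.nonedge {V : Type*} (G : FuzzyGraph V) : SimpleGraph V := (G.real ⊔ G.fuzzy)ᶜ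

/-- `H` is `c`-closed: any two nonadjacent vertices have less than `c` common neighbours. -/
def IsClosedGraph {V : Type*} (H : SimpleGraph V) (c : ℕ) : Prop :=
  ∀ u v : V, u ≠ v → ¬ H.Adj u v → (H.commonNeighbors u v).ncard < c

/-- The closure of a (finite) graph: the smallest `c` for which it is `c`-closed. -/
noncomputable def graphClosure {V : Type*} (H : SimpleGraph V) : ℕ := sInf {c | IsClosedGraph H c}

/-! ## Correlation Clustering -/

/-- An instance of Correlation Clustering on the vertex set `{0, …, n - 1}`: a fuzzy graph, a
weight function on the vertex pairs whose zeros are exactly the fuzzy edges, and the budget `k`.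
The diagonal of `Sym2` holds no vertex pairs; weights there are normalized to `0`. -/
structure CCInstance where
  n : ℕ
  graph : FuzzyGraph (Fin n)
  weight : Sym2 (Fin n) → ℕ
  weight_diag : ∀ v : Fin n, weight s(v, v) = 0
  weight_eq_zero_iff : ∀ u v : Fin n, u ≠ v → (weight s(u, v) = 0 ↔ graph.fuzzy.Adj u v)
  k : ℕ

namespace CCInstance

variable (I : CCInstance)

/-- The two ends of `e` lie in the same cluster of the clustering `C`. A clustering is a partition
of the vertex set, given as an equivalence relation whose classes are the clusters. -/
def Together {V : Type*} (C : Setoid V) (e : Sym2 V) : Prop := ∀ u ∈ e, ∀ v ∈ e, C u v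

open Classical in
/-- Positive mistakes: real edges between different clusters. -/
noncomputable def positiveMistakes (C : Setoid (Fin I.n)) : Finset (Sym2 (Fin I.n)) :=
  {e | e ∈ I.graph.real.edgeSet ∧ ¬ Together C e}

open Classical in
/-- Negative mistakes: nonedges inside a cluster. -/
noncomputable def negativeMistakes (C : Setoid (Fin I.n)) : Finset (Sym2 (Fin I.n)) :=
  {e | e ∈ I.graph.nonedge.edgeSet ∧ Together C e}

/-- The cost of a clustering: the total weight of its positive and negative mistakes. -/
noncomputable def cost (C : Setoid (Fin I.n)) : ℕ :=
  ∑ e ∈ I.positiveMistakes C, I.weight e + ∑ e ∈ I.negativeMistakes C, I.weight e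

/-- Yes-instances: some clustering has cost at most `k`. -/
def IsYes : Prop := ∃ C : Setoid (Fin I.n), I.cost C ≤ I.k

/-- The fuzzy closure: the closure of the graph of the fuzzy edges. -/
noncomputable def fuzzyClosure : ℕ := graphClosure I.graph.fuzzy

/-- The encoding length of an instance: a constant number of bits per ordered pair of vertices for
the adjacency data, and the bit lengths of the number of vertices, of `k` and of all weights. -/
def size : ℕ :=
  I.n ^ 2 + Nat.size I.n + Nat.size I.k + ∑ i : Fin I.n, ∑ j : Fin I.n, Nat.size (I.weight s(i, j))

end CCInstance

/-! ## Random access machines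

Structured programs for a random access machine with registers and arrays of natural numbers,
indirect addressing, addition and truncated subtraction (no multiplication), at unit cost per
operation. Each operation lengthens the largest stored number by at most one bit, so polynomial
time on this machine is polynomial time in the usual sense. -/

/-- Memory of the machine: registers and arrays, all addressed by natural numbers. -/
structure Memory where
  reg : ℕ → ℕ
  arr : ℕ → ℕ → ℕ

/-- Expressions; `get a e` reads the cell with address `e` of the array number `a`. -/
inductive Expr where
  | const (m : ℕ)
  | reg (r : ℕ)
  | get (a : ℕ) (e : Expr)
  | add (e f : Expr)
  | sub (e f : Expr)

namespace Expr

def eval (s : Memory) : Expr → ℕ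
  | const m => m
  | reg r => s.reg r
  | get a e => s.arr a (e.eval s)
  | add e f => e.eval s + f.eval s
  | sub e f => e.eval s - f.eval s

/-- The number of operations that are needed to evaluate an expression. -/
def cost : Expr → ℕ
  | const _ => 1
  | reg _ => 1
  | get _ e => e.cost + 1
  | add e f => e.cost + f.cost + 1
  | sub e f => e.cost + f.cost + 1

end Expr

/-- Programs. A branch or loop condition holds when its value is not `0`. -/
inductive Program where
  | skip
  | assign (r : ℕ) (e : Expr)
  | store (a : ℕ) (addr e : Expr)
  | seq (p q : Program)
  | cond (b : Expr) (p q : Program)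
  | loop (b : Expr) (p : Program)

def Memory.setReg (s : Memory) (r x : ℕ) : Memory :=
  { s with reg := Function.update s.reg r x }

def Memory.setArr (s : Memory) (a i x : ℕ) : Memory :=
  { s with arr := Function.update s.arr a (Function.update (s.arr a) i x) }

/-- `Exec p s s' t`: the program `p`, started in memory `s`, halts in memory `s'` after `t` steps. -/
inductive Exec : Program → Memory → Memory → ℕ → Prop
  | skip (s : Memory) : Exec Program.skip s s 1
  | assign (r : ℕ) (e : Expr) (s : Memory) :
      Exec (Program.assign r e) s (s.setReg r (e.eval s)) (e.cost + 1)
  | store (a : ℕ) (addr e : Expr) (s : Memory) :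
      Exec (Program.store a addr e) s (s.setArr a (addr.eval s) (e.eval s))
        (addr.cost + e.cost + 1)
  | seq {p q : Program} {s₀ s₁ s₂ : Memory} {t₁ t₂ : ℕ} :
      Exec p s₀ s₁ t₁ → Exec q s₁ s₂ t₂ → Exec (Program.seq p q) s₀ s₂ (t₁ + t₂)
  | cond_true {b : Expr} {p q : Program} {s s' : Memory} {t : ℕ} :
      b.eval s ≠ 0 → Exec p s s' t → Exec (Program.cond b p q) s s' (b.cost + 1 + t)
  | cond_false {b : Expr} {p q : Program} {s s' : Memory} {t : ℕ} :
      b.eval s = 0 → Exec q s s' t → Exec (Program.cond b p q) s s' (b.cost + 1 + t)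
  | loop_true {b : Expr} {p : Program} {s₀ s₁ s₂ : Memory} {t₁ t₂ : ℕ} :
      b.eval s₀ ≠ 0 → Exec p s₀ s₁ t₁ → Exec (Program.loop b p) s₁ s₂ t₂ →
      Exec (Program.loop b p) s₀ s₂ (b.cost + 1 + t₁ + t₂)
  | loop_false {b : Expr} {p : Program} {s : Memory} :
      b.eval s = 0 → Exec (Program.loop b p) s s (b.cost + 1)

/-! ## Instances in memory

Register `0` holds the number `n` of vertices and register `1` the budget `k`. Arrays `0`, `1`
and `2` hold, row by row, the adjacency matrix of the real edges, that of the fuzzy edges, and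
the matrix of the weights. -/

namespace CCInstance

variable (I : CCInstance)

/-- The memory `s` contains the instance `I`. -/
structure StoredIn (s : Memory) : Prop where
  n_eq : s.reg 0 = I.n
  k_eq : s.reg 1 = I.k
  real_iff : ∀ i j : Fin I.n,
    (I.graph.real.Adj i j → s.arr 0 (i * I.n + j) = 1) ∧
    (¬ I.graph.real.Adj i j → s.arr 0 (i * I.n + j) = 0)
  fuzzy_iff : ∀ i j : Fin I.n,
    (I.graph.fuzzy.Adj i j → s.arr 1 (i * I.n + j) = 1) ∧
    (¬ I.graph.fuzzy.Adj i j → s.arr 1 (i * I.n + j) = 0)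
  weight_eq : ∀ i j : Fin I.n, s.arr 2 (i * I.n + j) = I.weight s(i, j)

/-- The memory `s` contains the instance `I`, and every other cell is `0`. -/
structure InitialMemory (s : Memory) : Prop extends I.StoredIn s where
  reg_eq_zero : ∀ r, 2 ≤ r → s.reg r = 0
  arr_eq_zero : ∀ a m, (3 ≤ a ∨ I.n * I.n ≤ m) → s.arr a m = 0

end CCInstance

end CorrelationClustering

open CorrelationClustering

/-! A vertex `v` is redundant if some other vertex `u` certifies it: every real neighbour of `v` is
`u` or has more than `k` common real neighbours with `u`, and for every nonneighbour `z` of `v` more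
than `k` vertices are joined to `u` by a real edge and to `z` by a nonedge. Separating the former
from `u`, or putting `z` together with `u`, costs one mistake per witness. A clustering of cost at
most `k` does neither, so `v` can be deleted and later joins the cluster of `u` for free
(`Redundant.yesOn_erase_iff`). Components of the real edges without a nonedge are free clusters; the
rest is the core (`yesOn_core_iff`).

Suppose that no vertex is redundant and some clustering costs at most `k`. Mistakes touch at most
`2k` vertices, and every core vertex shares its cluster with such an affected vertex
(`exists_affected_of_mem_core`). The fuzzy closure `c` enters twice. An unaffected vertex with a
real neighbour has at most `2c + 2k - 2` fuzzy neighbours in its cluster, because more of them would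
supply the witnesses for redundancy (`card_fuzzyIn_add_two_le`). And in a cluster with many ordinary
vertices, fewer than `c` outside vertices have few nonneighbours there, because otherwise two
cluster vertices that are not fuzzy neighbours would have `c` common fuzzy neighbours
(`card_ordinaryIn_lt`). Each affected vertex thus accounts for itself, for at most `2c + 3k` real
neighbours if it has that few in its cluster, and for fewer than `c(2c + 3k) + 2c + 2k` ordinary
vertices. This sums up to at most `30k²c²` core vertices (`card_core_le`). A larger core proves a
no-instance and is replaced by a fixed path on three vertices. Truncating weights at `k + 1` keeps
the encoding short.

For the running time, terms and statements whose loops all run over the numbers below `n` are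
compiled to machine code, with a time bound that is a polynomial in `n` by construction
(`Tm.runs_compile`, `Stmt.runs_compile`). What is left is the correctness of one statement,
`Stmt.kernelize`. -/

namespace CorrelationClustering

/-! ### Mistakes, costs and redundant vertices -/

namespace CCInstance

variable (I : CCInstance)

/-- `u` and `v` are a mistake of the clustering `C`. -/
def Mistake (C : Setoid (Fin I.n)) (u v : Fin I.n) : Prop :=
  (I.graph.real.Adj u v ∧ ¬ C u v) ∨ (I.graph.nonedge.Adj u v ∧ C u v)

open Classical in
/-- The mistakes of a clustering within a set of vertices. -/
noncomputable def mistakesOn (S : Finset (Fin I.n)) (C : Setoid (Fin I.n)) :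
    Finset (Sym2 (Fin I.n)) :=
  S.sym2.filter fun e => (e ∈ I.graph.real.edgeSet ∧ ¬ Together C e) ∨
    (e ∈ I.graph.nonedge.edgeSet ∧ Together C e)

/-- The cost of a clustering within a set of vertices. -/
noncomputable def costOn (S : Finset (Fin I.n)) (C : Setoid (Fin I.n)) : ℕ :=
  ∑ e ∈ I.mistakesOn S C, I.weight e

/-- The instance induced by a set of vertices is a yes-instance. -/
def YesOn (S : Finset (Fin I.n)) : Prop := ∃ C : Setoid (Fin I.n), I.costOn S C ≤ I.k

theorem together_mk {V : Type*} (C : Setoid V) (u v : V) : Together C s(u, v) ↔ C u v := by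
  constructor
  · intro h
    exact h u (Sym2.mem_mk_left u v) v (Sym2.mem_mk_right u v)
  · intro h a ha b hb
    rw [Sym2.mem_iff] at ha hb
    rcases ha with rfl | rfl <;> rcases hb with rfl | rfl
    · exact C.refl _
    · exact h
    · exact C.symm h
    · exact C.refl _

variable {I}

theorem mem_mistakesOn {S : Finset (Fin I.n)} {C : Setoid (Fin I.n)} {u v : Fin I.n} :
    s(u, v) ∈ I.mistakesOn S C ↔ u ∈ S ∧ v ∈ S ∧ I.Mistake C u v := by
  simp [mistakesOn, Mistake, together_mk, and_assoc]

theorem nonedge_adj {u v : Fin I.n} :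
    I.graph.nonedge.Adj u v ↔ u ≠ v ∧ ¬ I.graph.real.Adj u v ∧ ¬ I.graph.fuzzy.Adj u v := by
  simp only [FuzzyGraph.nonedge, SimpleGraph.compl_adj, SimpleGraph.sup_adj, not_or, ne_eq]

theorem not_fuzzy_of_real {u v : Fin I.n} (h : I.graph.real.Adj u v) :
    ¬ I.graph.fuzzy.Adj u v := fun h' =>
  (SimpleGraph.disjoint_left.mp I.graph.disjoint) u v h h'

theorem not_fuzzy_of_nonedge {u v : Fin I.n} (h : I.graph.nonedge.Adj u v) :
    ¬ I.graph.fuzzy.Adj u v := (nonedge_adj.mp h).2.2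

theorem real_or_fuzzy_or_nonedge {u v : Fin I.n} (h : u ≠ v) :
    I.graph.real.Adj u v ∨ I.graph.fuzzy.Adj u v ∨ I.graph.nonedge.Adj u v := by
  rw [nonedge_adj]; tauto

theorem Mistake.symm {C : Setoid (Fin I.n)} {u v : Fin I.n} (h : I.Mistake C u v) :
    I.Mistake C v u := by
  rcases h with h | h
  · exact Or.inl ⟨h.1.symm, fun h' => h.2 (C.symm h')⟩
  · exact Or.inr ⟨h.1.symm, C.symm h.2⟩

theorem Mistake.ne {C : Setoid (Fin I.n)} {u v : Fin I.n} (h : I.Mistake C u v) : u ≠ v := by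
  rcases h with h | h
  · exact h.1.ne
  · exact h.1.ne

theorem Mistake.not_fuzzy {C : Setoid (Fin I.n)} {u v : Fin I.n} (h : I.Mistake C u v) :
    ¬ I.graph.fuzzy.Adj u v := by
  rcases h with h | h
  · exact not_fuzzy_of_real h.1
  · exact not_fuzzy_of_nonedge h.1

theorem cost_eq_costOn (C : Setoid (Fin I.n)) : I.cost C = I.costOn Finset.univ C := by
  classical
  have hd : Disjoint (I.positiveMistakes C) (I.negativeMistakes C) := by
    rw [Finset.disjoint_left]
    intro e h1 h2
    simp only [positiveMistakes, negativeMistakes, Finset.mem_filter] at h1 h2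
    exact h1.2.2 h2.2.2
  rw [cost, costOn, ← Finset.sum_union hd]
  refine Finset.sum_congr ?_ fun _ _ => rfl
  ext e
  simp [positiveMistakes, negativeMistakes, mistakesOn]

theorem isYes_iff_yesOn : I.IsYes ↔ I.YesOn Finset.univ := by
  simp only [IsYes, YesOn, cost_eq_costOn]

/-- A mistake is never a fuzzy pair, hence weighs at least `1`. All later arguments count mistakes
and ignore weights. -/
theorem card_mistakesOn_le (S : Finset (Fin I.n)) (C : Setoid (Fin I.n)) :
    (I.mistakesOn S C).card ≤ I.costOn S C := by
  rw [costOn, Finset.card_eq_sum_ones]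
  refine Finset.sum_le_sum fun e he => ?_
  induction e with
  | _ u v =>
    have h := (mem_mistakesOn.mp he).2.2
    have := (I.weight_eq_zero_iff u v h.ne).not.mpr h.not_fuzzy
    omega

theorem costOn_le_of_mistake {S T : Finset (Fin I.n)} {C D : Setoid (Fin I.n)}
    (h : ∀ u ∈ S, ∀ v ∈ S, I.Mistake C u v → u ∈ T ∧ v ∈ T ∧ I.Mistake D u v) :
    I.costOn S C ≤ I.costOn T D := by
  refine Finset.sum_le_sum_of_subset fun e he => ?_
  induction e with
  | _ u v =>
    obtain ⟨hu, hv, hm⟩ := mem_mistakesOn.mp he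
    exact mem_mistakesOn.mpr (h u hu v hv hm)

theorem YesOn.mono {S T : Finset (Fin I.n)} (h : S ⊆ T) (hT : I.YesOn T) : I.YesOn S := by
  obtain ⟨C, hC⟩ := hT
  exact ⟨C, (costOn_le_of_mistake fun u hu v hv hm => ⟨h hu, h hv, hm⟩).trans hC⟩

/-- Distinct vertices that form a mistake with one of two given vertices yield distinct mistakes. -/
theorem card_le_costOn {S W : Finset (Fin I.n)} {C : Setoid (Fin I.n)} {x y : Fin I.n}
    (hW : W ⊆ S) (hx : x ∈ S) (hy : y ∈ S) (hxW : x ∉ W) (hyW : y ∉ W)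
    (h : ∀ w ∈ W, I.Mistake C x w ∨ I.Mistake C y w) : W.card ≤ I.costOn S C := by
  classical
  refine le_trans ?_ (card_mistakesOn_le S C)
  refine Finset.card_le_card_of_injOn
    (fun w => if I.Mistake C x w then s(x, w) else s(y, w)) ?_ ?_
  · intro w hw
    have hw' : w ∈ W := hw
    simp only [Finset.mem_coe]
    split_ifs with hm
    · exact mem_mistakesOn.mpr ⟨hx, hW hw', hm⟩
    · exact mem_mistakesOn.mpr ⟨hy, hW hw', (h w hw').resolve_left hm⟩
  · intro w hw w' hw' he
    have hw : w ∈ W := hw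
    have hw' : w' ∈ W := hw'
    have h1 : x ≠ w := fun e => hxW (e ▸ hw)
    have h2 : x ≠ w' := fun e => hxW (e ▸ hw')
    have h3 : y ≠ w := fun e => hyW (e ▸ hw)
    have h4 : y ≠ w' := fun e => hyW (e ▸ hw')
    dsimp only at he
    split_ifs at he <;> simp only [Sym2.eq_iff] at he <;> grind

variable (I) in
open Classical in
/-- Every clustering of cost at most `k` of `S` without `v` extends to `S` at no cost: all real
neighbours of `v` are in the cluster of `u`, and all its nonneighbours are not. -/
def Redundant (S : Finset (Fin I.n)) (v : Fin I.n) : Prop :=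
  v ∈ S ∧ ∃ u, u ∈ S ∧ u ≠ v ∧
    (∀ x, x ∈ S ∧ I.graph.real.Adj v x → x = u ∨ I.k < (Finset.univ.filter fun w =>
      (w ∈ S ∧ w ≠ v) ∧ I.graph.real.Adj x w ∧ I.graph.real.Adj u w).card) ∧
    (∀ z, z ∈ S ∧ I.graph.nonedge.Adj v z → I.k < (Finset.univ.filter fun w =>
      (w ∈ S ∧ w ≠ v) ∧ I.graph.real.Adj u w ∧ I.graph.nonedge.Adj z w).card)

/-- More than `k` witnesses force the real neighbours of `v` into the cluster of `u` and keep its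
nonneighbours out, since each violation would give a separate mistake per witness. Placing `v` next
to `u` then creates no mistake at `v`. -/
theorem Redundant.yesOn_erase_iff {S : Finset (Fin I.n)} {v : Fin I.n} (h : I.Redundant S v) :
    I.YesOn (S.erase v) ↔ I.YesOn S := by
  classical
  refine ⟨?_, YesOn.mono (Finset.erase_subset v S)⟩
  rintro ⟨C, hC⟩
  obtain ⟨hv, u, hu, huv, hR, hN⟩ := h
  have hu' : u ∈ S.erase v := Finset.mem_erase.mpr ⟨huv, hu⟩
  have key1 : ∀ x ∈ S, I.graph.real.Adj v x → C u x := by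
    intro x hx hvx
    rcases hR x ⟨hx, hvx⟩ with rfl | hlt
    · exact C.refl _
    by_contra hux
    refine absurd (hlt.trans_le ?_) (lt_irrefl I.k)
    refine le_trans (card_le_costOn (x := u) (y := x) ?_ hu'
      (Finset.mem_erase.mpr ⟨hvx.ne', hx⟩) ?_ ?_ ?_) hC
    · intro w hw
      have := (Finset.mem_filter.mp hw).2.1
      exact Finset.mem_erase.mpr ⟨this.2, this.1⟩
    · simp
    · simp
    · intro w hw
      obtain ⟨-, hxw, huw⟩ := (Finset.mem_filter.mp hw).2
      by_cases h1 : C u w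
      · exact Or.inr (Or.inl ⟨hxw, fun h2 => hux (C.trans h1 (C.symm h2))⟩)
      · exact Or.inl (Or.inl ⟨huw, h1⟩)
  have key2 : ∀ z ∈ S, I.graph.nonedge.Adj v z → ¬ C u z := by
    intro z hz hvz huz
    refine absurd ((hN z ⟨hz, hvz⟩).trans_le ?_) (lt_irrefl I.k)
    refine le_trans (card_le_costOn (x := u) (y := z) ?_ hu'
      (Finset.mem_erase.mpr ⟨hvz.ne', hz⟩) ?_ ?_ ?_) hC
    · intro w hw
      have := (Finset.mem_filter.mp hw).2.1
      exact Finset.mem_erase.mpr ⟨this.2, this.1⟩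
    · simp
    · simp
    · intro w hw
      obtain ⟨-, huw, hzw⟩ := (Finset.mem_filter.mp hw).2
      by_cases h1 : C u w
      · exact Or.inr (Or.inr ⟨hzw, C.trans (C.symm huz) h1⟩)
      · exact Or.inl (Or.inl ⟨huw, h1⟩)
  -- Pulling `C` back along `f` moves `v` into the cluster of `u` and leaves the other vertices
  -- alone.
  let f : Fin I.n → Fin I.n := fun x => if x = v then u else x
  have hf : ∀ x, x ≠ v → f x = x := fun x hx => if_neg hx
  have hfv : f v = u := if_pos rfl
  have hvx : ∀ x ∈ S, ¬ I.Mistake (C.comap f) v x := by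
    intro x hx hm
    have hxv : x ≠ v := (Mistake.ne hm).symm
    rcases hm with ⟨h1, h2⟩ | ⟨h1, h2⟩
    · rw [Setoid.comap_rel, hfv, hf x hxv] at h2
      exact h2 (key1 x hx h1)
    · rw [Setoid.comap_rel, hfv, hf x hxv] at h2
      exact key2 x hx h1 h2
  refine ⟨C.comap f, (costOn_le_of_mistake ?_).trans hC⟩
  intro a ha b hb hm
  have hav : a ≠ v := by rintro rfl; exact hvx b hb hm
  have hbv : b ≠ v := by rintro rfl; exact hvx a ha hm.symm
  refine ⟨Finset.mem_erase.mpr ⟨hav, ha⟩, Finset.mem_erase.mpr ⟨hbv, hb⟩, ?_⟩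
  simpa only [Mistake, Setoid.comap_rel, hf a hav, hf b hbv] using hm

/-! ### Components without nonedges -/

variable (I) in
/-- The real edges within `S`. -/
def realOn (S : Finset (Fin I.n)) : SimpleGraph (Fin I.n) where
  Adj x y := x ∈ S ∧ y ∈ S ∧ I.graph.real.Adj x y
  symm.symm _ _ h := ⟨h.2.1, h.1, h.2.2.symm⟩
  loopless.irrefl _ h := h.2.2.ne rfl

variable (I) in
open Classical in
/-- The vertices of `S` whose component of real edges contains a nonedge. -/
noncomputable def core (S : Finset (Fin I.n)) : Finset (Fin I.n) :=
  Finset.univ.filter fun v => v ∈ S ∧ ∃ x y, (I.realOn S).Reachable v x ∧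
    (I.realOn S).Reachable v y ∧ (x ∈ S ∧ y ∈ S) ∧ I.graph.nonedge.Adj x y

theorem mem_core {S : Finset (Fin I.n)} {v : Fin I.n} : v ∈ I.core S ↔
    v ∈ S ∧ ∃ x y, (I.realOn S).Reachable v x ∧
      (I.realOn S).Reachable v y ∧ (x ∈ S ∧ y ∈ S) ∧ I.graph.nonedge.Adj x y := by
  simp only [core, Finset.mem_filter, Finset.mem_univ, true_and]

theorem core_subset (S : Finset (Fin I.n)) : I.core S ⊆ S := fun _ h => (mem_core.mp h).1

theorem mem_core_of_reachable {S : Finset (Fin I.n)} {u v : Fin I.n} (hu : u ∈ I.core S)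
    (hv : v ∈ S) (h : (I.realOn S).Reachable u v) : v ∈ I.core S := by
  obtain ⟨-, x, y, hx, hy, hxy⟩ := mem_core.mp hu
  exact mem_core.mpr
    ⟨hv, x, y, h.symm.trans hx, h.symm.trans hy, hxy⟩

/-- The core is a union of components of the real edges. Keeping the given clusters on it and making
every other component a cluster of its own cuts no further real edge and encloses no further
nonedge. -/
theorem yesOn_core_iff (S : Finset (Fin I.n)) : I.YesOn (I.core S) ↔ I.YesOn S := by
  classical
  refine ⟨?_, YesOn.mono (core_subset S)⟩
  rintro ⟨C, hC⟩
  let f : Fin I.n → Quotient C ⊕ (I.realOn S).ConnectedComponent := fun x =>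
    if x ∈ I.core S then Sum.inl (Quotient.mk C x)
    else Sum.inr ((I.realOn S).connectedComponentMk x)
  refine ⟨Setoid.ker f, (costOn_le_of_mistake ?_).trans hC⟩
  intro a ha b hb hm
  simp only [Mistake, Setoid.ker_def] at hm
  by_cases haS : a ∈ I.core S <;> by_cases hbS : b ∈ I.core S
  · refine ⟨haS, hbS, ?_⟩
    simp only [f, if_pos haS, if_pos hbS, Sum.inl.injEq] at hm
    have : (Quotient.mk C a = Quotient.mk C b) ↔ C a b := Quotient.eq
    rwa [this] at hm
  · exfalso
    simp only [f, if_pos haS, if_neg hbS] at hm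
    rcases hm with ⟨h1, -⟩ | ⟨-, h2⟩
    · exact hbS (mem_core_of_reachable haS hb (SimpleGraph.Adj.reachable ⟨ha, hb, h1⟩))
    · cases h2
  · exfalso
    simp only [f, if_neg haS, if_pos hbS] at hm
    rcases hm with ⟨h1, -⟩ | ⟨-, h2⟩
    · exact haS (mem_core_of_reachable hbS ha (SimpleGraph.Adj.reachable ⟨hb, ha, h1.symm⟩))
    · cases h2
  · exfalso
    simp only [f, if_neg haS, if_neg hbS, Sum.inr.injEq, SimpleGraph.ConnectedComponent.eq] at hm
    rcases hm with ⟨h1, h2⟩ | ⟨h1, h2⟩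
    · exact h2 (SimpleGraph.Adj.reachable ⟨ha, hb, h1⟩)
    · exact haS (mem_core.mpr
        ⟨ha, a, b, SimpleGraph.Reachable.refl a, h2, ⟨ha, hb⟩, h1⟩)

theorem exists_real_of_mem_core {S : Finset (Fin I.n)} {v : Fin I.n} (h : v ∈ I.core S) :
    ∃ u ∈ S, I.graph.real.Adj v u := by
  obtain ⟨-, x, y, hx, hy, -, hxy⟩ := mem_core.mp h
  have aux : ∀ z, (I.realOn S).Reachable v z → v ≠ z → ∃ u ∈ S, I.graph.real.Adj v u := by
    rintro z ⟨p⟩ hz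
    cases p with
    | nil => exact absurd rfl hz
    | cons hadj _ => exact ⟨_, hadj.2.1, hadj.2.2⟩
  by_cases hvx : v = x
  · exact aux y hy fun e => hxy.ne (hvx.symm.trans e)
  · exact aux x hx hvx

end CCInstance

theorem isClosedGraph_graphClosure {V : Type*} [Finite V] (H : SimpleGraph V) :
    IsClosedGraph H (graphClosure H) := by
  refine Nat.sInf_mem (s := {c | IsClosedGraph H c}) ⟨Nat.card V + 1, fun u v _ _ => ?_⟩
  exact Nat.lt_succ_of_le (Set.ncard_le_card _)

open Classical in
theorem IsClosedGraph.card_lt {V : Type*} [Fintype V] {H : SimpleGraph V} {c : ℕ}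
    (h : IsClosedGraph H c) {u v : V} (huv : u ≠ v) (hadj : ¬ H.Adj u v) :
    (Finset.univ.filter fun w => H.Adj u w ∧ H.Adj v w).card < c := by
  have := h u v huv hadj
  rwa [show H.commonNeighbors u v =
    ((Finset.univ.filter fun w => H.Adj u w ∧ H.Adj v w : Finset V) : Set V) by
      ext w; simp [SimpleGraph.mem_commonNeighbors], Set.ncard_coe_finset] at this

/-! ### The vertex bound -/

namespace CCInstance

variable {I : CCInstance}

/-- No mistake of the clustering `C` within `S` is incident to `v`. -/
def Unaffected (S : Finset (Fin I.n)) (C : Setoid (Fin I.n)) (v : Fin I.n) : Prop :=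
  v ∈ S ∧ ∀ x ∈ S, ¬ I.Mistake C v x

theorem Unaffected.rel_of_real {S : Finset (Fin I.n)} {C : Setoid (Fin I.n)} {v x : Fin I.n}
    (h : Unaffected S C v) (hx : x ∈ S) (hvx : I.graph.real.Adj v x) : C v x := by
  by_contra hC
  exact h.2 x hx (Or.inl ⟨hvx, hC⟩)

theorem Unaffected.not_rel_of_nonedge {S : Finset (Fin I.n)} {C : Setoid (Fin I.n)}
    {v x : Fin I.n} (h : Unaffected S C v) (hx : x ∈ S) (hvx : I.graph.nonedge.Adj v x) :
    ¬ C v x := fun hC => h.2 x hx (Or.inr ⟨hvx, hC⟩)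

open Classical in
/-- The fuzzy neighbours of `v` in its own cluster. -/
noncomputable def fuzzyIn (S : Finset (Fin I.n)) (C : Setoid (Fin I.n)) (v : Fin I.n) :
    Finset (Fin I.n) :=
  S.filter fun w => C v w ∧ I.graph.fuzzy.Adj v w

open Classical in
/-- The real neighbours of `v` in its own cluster. -/
noncomputable def realIn (S : Finset (Fin I.n)) (C : Setoid (Fin I.n)) (v : Fin I.n) :
    Finset (Fin I.n) :=
  S.filter fun w => C v w ∧ I.graph.real.Adj v w

/-- With more fuzzy neighbours in its cluster, `v` would be redundant with certificate `u`, and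
these fuzzy neighbours would be the witnesses. Real neighbours of `v` lie in its cluster and
nonneighbours outside, so apart from fuzzy pairs and mistakes the former have real edges to the
witnesses and the latter nonedges. -/
theorem card_fuzzyIn_add_two_le {S : Finset (Fin I.n)} {C : Setoid (Fin I.n)}
    {c : ℕ} (hC : I.costOn S C ≤ I.k) (hred : ∀ v, ¬ I.Redundant S v)
    (hc : IsClosedGraph I.graph.fuzzy c) {u v : Fin I.n} (hv : Unaffected S C v) (hu : u ∈ S)
    (huv : I.graph.real.Adj v u) : (fuzzyIn S C v).card + 2 ≤ 2 * c + 2 * I.k := by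
  classical
  by_contra hlt
  have mem_N : ∀ {w}, w ∈ fuzzyIn S C v ↔ w ∈ S ∧ C v w ∧ I.graph.fuzzy.Adj v w := by
    intro w
    simp only [fuzzyIn, Finset.mem_filter]
  have hcom : ∀ x, v ≠ x → ¬ I.graph.fuzzy.Adj v x →
      (Finset.univ.filter fun w => I.graph.fuzzy.Adj v w ∧ I.graph.fuzzy.Adj x w).card < c := by
    intro x h1 h2
    convert hc.card_lt h1 h2
  have hmis : ∀ x y, x ∈ S → y ∈ S → ¬ I.graph.fuzzy.Adj v x → ¬ I.graph.fuzzy.Adj v y →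
      ((fuzzyIn S C v).filter fun w => I.Mistake C x w ∨ I.Mistake C y w).card ≤ I.k := by
    intro x y hx hy hvx hvy
    refine le_trans (card_le_costOn (x := x) (y := y) ?_ hx hy ?_ ?_ ?_) hC
    · intro w hw
      exact (mem_N.mp (Finset.mem_filter.mp hw).1).1
    · intro h
      exact hvx (mem_N.mp (Finset.mem_filter.mp h).1).2.2
    · intro h
      exact hvy (mem_N.mp (Finset.mem_filter.mp h).1).2.2
    · intro w hw
      exact (Finset.mem_filter.mp hw).2
  -- Of at least `2c + 2k - 1` fuzzy neighbours, at most `c - 1` are fuzzy neighbours of `x`, at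
  -- most `c - 1` of `y`, and at most `k` form a mistake with one of the two. At least `k + 1`
  -- remain.
  have hcover : ∀ (x y : Fin I.n) (W : Finset (Fin I.n)), x ∈ S → y ∈ S → v ≠ x → v ≠ y →
      ¬ I.graph.fuzzy.Adj v x → ¬ I.graph.fuzzy.Adj v y →
      (∀ w ∈ fuzzyIn S C v, ¬ I.graph.fuzzy.Adj x w → ¬ I.graph.fuzzy.Adj y w →
        ¬ I.Mistake C x w → ¬ I.Mistake C y w → w ∈ W) → I.k < W.card := by
    intro x y W hx hy hvx hvy hfx hfy hW
    have hsub : fuzzyIn S C v ⊆ W ∪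
        (Finset.univ.filter fun w => I.graph.fuzzy.Adj v w ∧ I.graph.fuzzy.Adj x w) ∪
        (Finset.univ.filter fun w => I.graph.fuzzy.Adj v w ∧ I.graph.fuzzy.Adj y w) ∪
        ((fuzzyIn S C v).filter fun w => I.Mistake C x w ∨ I.Mistake C y w) := by
      intro w hw
      have := hW w hw
      have hw' := (mem_N.mp hw).2.2
      simp only [Finset.mem_union, Finset.mem_filter, Finset.mem_univ, true_and, hw, hw']
      by_contra! hn
      exact hn.1.1.1 (this hn.1.1.2 hn.1.2 hn.2.1 hn.2.2)
    have h1 := Finset.card_le_card hsub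
    have h2 := hcom x hvx hfx
    have h3 := hcom y hvy hfy
    have h4 := hmis x y hx hy hfx hfy
    have h5 := Finset.card_union_le (W ∪
        (Finset.univ.filter fun w => I.graph.fuzzy.Adj v w ∧ I.graph.fuzzy.Adj x w) ∪
        (Finset.univ.filter fun w => I.graph.fuzzy.Adj v w ∧ I.graph.fuzzy.Adj y w))
        ((fuzzyIn S C v).filter fun w => I.Mistake C x w ∨ I.Mistake C y w)
    have h6 := Finset.card_union_le (W ∪
        (Finset.univ.filter fun w => I.graph.fuzzy.Adj v w ∧ I.graph.fuzzy.Adj x w))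
        (Finset.univ.filter fun w => I.graph.fuzzy.Adj v w ∧ I.graph.fuzzy.Adj y w)
    have h7 := Finset.card_union_le W
        (Finset.univ.filter fun w => I.graph.fuzzy.Adj v w ∧ I.graph.fuzzy.Adj x w)
    omega
  have hreal : ∀ x w, x ∈ S → I.graph.real.Adj v x → w ∈ fuzzyIn S C v →
      ¬ I.graph.fuzzy.Adj x w → ¬ I.Mistake C x w → I.graph.real.Adj x w := by
    intro x w hx hvx hw hf hm
    obtain ⟨-, h2, h3⟩ := mem_N.mp hw
    have hxw : x ≠ w := by
      rintro rfl
      exact not_fuzzy_of_real hvx h3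
    rcases real_or_fuzzy_or_nonedge hxw with h | h | h
    · exact h
    · exact absurd h hf
    · exact absurd (Or.inr ⟨h, C.trans (C.symm (hv.rel_of_real hx hvx)) h2⟩) hm
  refine hred v ⟨hv.1, u, hu, huv.ne', ?_, ?_⟩
  · rintro x ⟨hx, hvx⟩
    refine Or.inr (hcover x u _ hx hu hvx.ne huv.ne (not_fuzzy_of_real hvx)
      (not_fuzzy_of_real huv) ?_)
    intro w hw h1 h2 h3 h4
    have hw' := mem_N.mp hw
    exact Finset.mem_filter.mpr ⟨Finset.mem_univ _, ⟨hw'.1, hw'.2.2.ne'⟩,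
      hreal x w hx hvx hw h1 h3, hreal u w hu huv hw h2 h4⟩
  · rintro z ⟨hz, hvz⟩
    refine hcover z u _ hz hu hvz.ne huv.ne (not_fuzzy_of_nonedge hvz) (not_fuzzy_of_real huv) ?_
    intro w hw h1 h2 h3 h4
    have hw' := mem_N.mp hw
    refine Finset.mem_filter.mpr ⟨Finset.mem_univ _, ⟨hw'.1, hw'.2.2.ne'⟩,
      hreal u w hu huv hw h2 h4, ?_⟩
    have hzw : z ≠ w := by
      rintro rfl
      exact not_fuzzy_of_nonedge hvz hw'.2.2
    have hnC : ¬ C z w := fun h =>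
      hv.not_rel_of_nonedge hz hvz (C.trans hw'.2.1 (C.symm h))
    rcases real_or_fuzzy_or_nonedge hzw with h | h | h
    · exact absurd (Or.inl ⟨h, hnC⟩) h3
    · exact absurd h h1
    · exact h

/-- An affected vertex with few real neighbours in its cluster is a real neighbour of `v`. -/
def NearSparse (S : Finset (Fin I.n)) (C : Setoid (Fin I.n)) (s : ℕ) (v : Fin I.n) : Prop :=
  ∃ x ∈ S, ¬ Unaffected S C x ∧ I.graph.real.Adj x v ∧ C x v ∧ (realIn S C x).card ≤ s

open Classical in
/-- The ordinary vertices of the core in the cluster of `b`. -/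
noncomputable def ordinaryIn (S : Finset (Fin I.n)) (C : Setoid (Fin I.n)) (s : ℕ)
    (b : Fin I.n) : Finset (Fin I.n) :=
  (I.core S).filter fun v => Unaffected S C v ∧ C b v ∧ ¬ NearSparse S C s v

/-- In a larger set of ordinary vertices some `v` has a nonedge to no outside vertex with few
nonneighbours in the cluster. This `v` is redundant, and any other ordinary vertex `u` of the
cluster certifies it, because `u` has real edges to almost the whole cluster. -/
theorem card_ordinaryIn_lt {S : Finset (Fin I.n)} {C : Setoid (Fin I.n)} {c : ℕ} (hc0 : 1 ≤ c)
    (hC : I.costOn S C ≤ I.k) (hred : ∀ v, ¬ I.Redundant S v)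
    (hc : IsClosedGraph I.graph.fuzzy c) (b : Fin I.n) :
    (ordinaryIn S C (2 * c + 3 * I.k) b).card <
      c * (2 * c + 3 * I.k) + 2 * c + 2 * I.k := by
  classical
  by_contra! hlt
  set s := 2 * c + 3 * I.k with hs
  set A := ordinaryIn S C s b with hA
  have mem_A : ∀ {v}, v ∈ A ↔ v ∈ I.core S ∧ Unaffected S C v ∧ C b v ∧ ¬ NearSparse S C s v := by
    intro v
    simp only [hA, ordinaryIn, Finset.mem_filter]
  have hAA : ∀ {u v}, u ∈ A → v ∈ A → C u v := fun hu hv =>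
    C.trans (C.symm (mem_A.mp hu).2.2.1) (mem_A.mp hv).2.2.1
  have hAS : ∀ {v}, v ∈ A → v ∈ S := fun hv => core_subset S (mem_A.mp hv).1
  have hdeg : ∀ {v}, v ∈ A → (fuzzyIn S C v).card + 2 ≤ 2 * c + 2 * I.k := by
    intro v hv
    obtain ⟨u, hu, huv⟩ := exists_real_of_mem_core (mem_A.mp hv).1
    exact card_fuzzyIn_add_two_le hC hred hc (mem_A.mp hv).2.1 hu huv
  have mem_F : ∀ {v w}, w ∈ fuzzyIn S C v ↔ w ∈ S ∧ C v w ∧ I.graph.fuzzy.Adj v w := by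
    intro v w
    simp only [fuzzyIn, Finset.mem_filter]
  have mem_R : ∀ {v w}, w ∈ realIn S C v ↔ w ∈ S ∧ C v w ∧ I.graph.real.Adj v w := by
    intro v w
    simp only [realIn, Finset.mem_filter]
  -- `Q z` is the set of potential witnesses against an outside vertex `z`, and `Z` consists of the
  -- outside vertices for which they may not suffice.
  let Q : Fin I.n → Finset (Fin I.n) := fun z => S.filter fun w => C b w ∧ I.graph.nonedge.Adj z w
  let Z := S.filter fun z => ¬ C b z ∧ (Q z).card ≤ s
  have hcardQ : ∀ Z' ⊆ Z, (A.filter fun v => ∃ z ∈ Z', I.graph.nonedge.Adj z v).card ≤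
      Z'.card * s := by
    intro Z' hZ'
    refine le_trans (Finset.card_le_card (t := Z'.biUnion Q) ?_)
      (Finset.card_biUnion_le_card_mul _ _ _ ?_)
    · intro v hv
      obtain ⟨hvA, z, hz, hzv⟩ := Finset.mem_filter.mp hv
      exact Finset.mem_biUnion.mpr
        ⟨z, hz, Finset.mem_filter.mpr ⟨hAS hvA, (mem_A.mp hvA).2.2.1, hzv⟩⟩
    · intro z hz
      exact (Finset.mem_filter.mp (hZ' hz)).2.2
  have hZ : Z.card < c := by
    by_contra! hZc
    obtain ⟨Z', hZ', hZ'c⟩ := Finset.exists_subset_card_eq hZc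
    have h1 := hcardQ Z' hZ'
    rw [hZ'c] at h1
    set A' := A.filter fun v => ¬ ∃ z ∈ Z', I.graph.nonedge.Adj z v with hA'
    have h2 : (A.filter fun v => ∃ z ∈ Z', I.graph.nonedge.Adj z v).card + A'.card = A.card :=
      Finset.card_filter_add_card_filter_not _
    have h3 : 2 * c + 2 * I.k ≤ A'.card := by omega
    obtain ⟨v₁, hv₁⟩ : A'.Nonempty := Finset.card_pos.mp (by omega)
    obtain ⟨hv₁A, hv₁Z⟩ := Finset.mem_filter.mp hv₁
    have h4 := hdeg hv₁A
    -- `v₁` and its fuzzy neighbours in the cluster are at most `2c + 2k - 1` vertices, one less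
    -- than `A'` is known to have.
    obtain ⟨v₂, hv₂, hv₂n⟩ : ∃ v₂ ∈ A', v₂ ∉ insert v₁ (fuzzyIn S C v₁) := by
      by_contra! hall
      have h5 := Finset.card_le_card hall
      have h6 := Finset.card_insert_le v₁ (fuzzyIn S C v₁)
      omega
    obtain ⟨hv₂A, hv₂Z⟩ := Finset.mem_filter.mp hv₂
    rw [Finset.mem_insert, not_or] at hv₂n
    have h12 : ¬ I.graph.fuzzy.Adj v₁ v₂ := fun h =>
      hv₂n.2 (mem_F.mpr ⟨hAS hv₂A, hAA hv₁A hv₂A, h⟩)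
    -- An unaffected vertex has no real edge leaving its cluster, so without nonedges to `Z'` all
    -- its pairs with `Z'` are fuzzy. The `c` vertices of `Z'` become common fuzzy neighbours of
    -- `v₁` and `v₂`.
    have hfz : ∀ v ∈ A, (¬ ∃ z ∈ Z', I.graph.nonedge.Adj z v) → ∀ z ∈ Z',
        I.graph.fuzzy.Adj v z := by
      intro v hvA hvZ z hz
      obtain ⟨hzS, hbz, -⟩ := Finset.mem_filter.mp (hZ' hz)
      have hvz : ¬ C v z := fun h => hbz (C.trans (mem_A.mp hvA).2.2.1 h)
      have hne : v ≠ z := by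
        rintro rfl
        exact hvz (C.refl _)
      rcases real_or_fuzzy_or_nonedge hne with h | h | h
      · exact absurd ((mem_A.mp hvA).2.1.rel_of_real hzS h) hvz
      · exact h
      · exact absurd ⟨z, hz, h.symm⟩ hvZ
    have h7 := hc.card_lt (Ne.symm hv₂n.1) h12
    have h8 : Z'.card ≤ (Finset.univ.filter fun w =>
        I.graph.fuzzy.Adj v₁ w ∧ I.graph.fuzzy.Adj v₂ w).card := by
      refine Finset.card_le_card fun z hz => Finset.mem_filter.mpr ⟨Finset.mem_univ _, ?_, ?_⟩
      · exact hfz v₁ hv₁A hv₁Z z hz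
      · exact hfz v₂ hv₂A hv₂Z z hz
    have h9 : (Finset.univ.filter fun w =>
        I.graph.fuzzy.Adj v₁ w ∧ I.graph.fuzzy.Adj v₂ w).card < c := by
      convert h7
    omega
  have h1 := hcardQ Z subset_rfl
  have h2 : Z.card * s ≤ c * s := Nat.mul_le_mul_right _ hZ.le
  have hcs : s ≤ c * s := Nat.le_mul_of_pos_left s hc0
  obtain ⟨v, hvA, hvZ⟩ : ∃ v ∈ A, v ∉ A.filter fun v => ∃ z ∈ Z, I.graph.nonedge.Adj z v := by
    by_contra! hall
    have := Finset.card_le_card hall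
    omega
  obtain ⟨u, huA, huv⟩ := Finset.exists_mem_ne (s := A) (by omega) v
  have hvZ' : ∀ z ∈ Z, ¬ I.graph.nonedge.Adj z v := fun z hz h =>
    hvZ (Finset.mem_filter.mpr ⟨hvA, z, hz, h⟩)
  have hvU := (mem_A.mp hvA).2.1
  have huU := (mem_A.mp huA).2.1
  have hdu := hdeg huA
  -- The choice `s = 2c + 3k` is made here: from `s + 1` vertices, `v`, `u` and the at most `2c + 2k
  -- - 2` fuzzy neighbours of `u` are discarded, and `k + 1` are left.
  have hcover : ∀ W X : Finset (Fin I.n), s < X.card →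
      (∀ w ∈ X, w ≠ v → w ≠ u → w ∉ fuzzyIn S C u → w ∈ W) → I.k < W.card := by
    intro W X hX hW
    have hsub : X ⊆ W ∪ {v, u} ∪ fuzzyIn S C u := by
      intro w hw
      have := hW w hw
      simp only [Finset.mem_union, Finset.mem_insert, Finset.mem_singleton]
      tauto
    have h3 := Finset.card_le_card hsub
    have h4 := Finset.card_union_le (W ∪ {v, u}) (fuzzyIn S C u)
    have h5 := Finset.card_union_le W {v, u}
    have h6 : ({v, u} : Finset (Fin I.n)).card ≤ 2 := Finset.card_le_two
    omega
  have hru : ∀ w ∈ S, C u w → w ≠ u → w ∉ fuzzyIn S C u → I.graph.real.Adj u w := by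
    intro w hw huw hne hf
    rcases real_or_fuzzy_or_nonedge (Ne.symm hne) with h | h | h
    · exact h
    · exact absurd (mem_F.mpr ⟨hw, huw, h⟩) hf
    · exact absurd huw (huU.not_rel_of_nonedge hw h)
  refine hred v ⟨hAS hvA, u, hAS huA, huv, ?_, ?_⟩
  · rintro x ⟨hx, hvx⟩
    right
    have hCvx : C v x := hvU.rel_of_real hx hvx
    have hux : C u x := C.trans (hAA huA hvA) hCvx
    -- If `x` is affected, this is what ordinariness of `v` provides. If `x` is unaffected, it has
    -- no nonedge inside the cluster and few fuzzy neighbours there, so at least `cs + 1` vertices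
    -- of `A` are its real neighbours.
    have hr : s < (realIn S C x).card := by
      by_cases hxU : Unaffected S C x
      · have h3 := card_fuzzyIn_add_two_le hC hred hc hxU (hAS hvA) hvx.symm
        have hsub : A ⊆ insert x (fuzzyIn S C x ∪ realIn S C x) := by
          intro a ha
          have hxa : C x a := C.trans (C.symm hux) (hAA huA ha)
          rw [Finset.mem_insert, Finset.mem_union]
          by_cases hax : a = x
          · exact Or.inl hax
          rcases real_or_fuzzy_or_nonedge (Ne.symm hax) with h | h | h
          · exact Or.inr (Or.inr (mem_R.mpr ⟨hAS ha, hxa, h⟩))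
          · exact Or.inr (Or.inl (mem_F.mpr ⟨hAS ha, hxa, h⟩))
          · exact absurd hxa (hxU.not_rel_of_nonedge (hAS ha) h)
        have h4 := Finset.card_le_card hsub
        have h5 := Finset.card_insert_le x (fuzzyIn S C x ∪ realIn S C x)
        have h6 := Finset.card_union_le (fuzzyIn S C x) (realIn S C x)
        omega
      · by_contra! hle
        exact (mem_A.mp hvA).2.2.2 ⟨x, hx, hxU, hvx.symm, C.symm hCvx, hle⟩
    refine hcover _ (realIn S C x) hr fun w hw hwv hwu hwf => ?_
    obtain ⟨hwS, hxw, hRxw⟩ := mem_R.mp hw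
    exact Finset.mem_filter.mpr ⟨Finset.mem_univ _, ⟨hwS, hwv⟩, hRxw,
      hru w hwS (C.trans hux hxw) hwu hwf⟩
  · rintro z ⟨hz, hvz⟩
    have hbz : ¬ C b z := fun h =>
      hvU.not_rel_of_nonedge hz hvz (C.trans (C.symm (mem_A.mp hvA).2.2.1) h)
    have hq : s < (Q z).card := by
      by_contra! hle
      exact hvZ' z (Finset.mem_filter.mpr ⟨hz, hbz, hle⟩) hvz.symm
    refine hcover _ (Q z) hq fun w hw hwv hwu hwf => ?_
    obtain ⟨hwS, hbw, hzw⟩ := Finset.mem_filter.mp hw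
    exact Finset.mem_filter.mpr ⟨Finset.mem_univ _, ⟨hwS, hwv⟩,
      hru w hwS (C.trans (C.symm (mem_A.mp huA).2.2.1) hbw) hwu hwf, hzw⟩

/-- In a cluster without affected vertices no real edge leaves, so the cluster contains the whole
component of `v`. The nonedge of that component would then be a mistake. -/
theorem exists_affected_of_mem_core {S : Finset (Fin I.n)} {C : Setoid (Fin I.n)} {v : Fin I.n}
    (hv : v ∈ I.core S) : ∃ b ∈ S, ¬ Unaffected S C b ∧ C b v := by
  by_contra! hall
  have hall' : ∀ b ∈ S, C v b → Unaffected S C b := fun b hb h => by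
    by_contra hn
    exact hall b hb hn (C.symm h)
  obtain ⟨hvS, x, y, hvx, hvy, ⟨hx, hy⟩, hxy⟩ := mem_core.mp hv
  have stay : ∀ a z, (I.realOn S).Reachable a z → C v a → C v z := by
    rintro a z ⟨p⟩ ha
    induction p with
    | nil => exact ha
    | cons h _ ih => exact ih (C.trans ha ((hall' _ h.1 ha).rel_of_real h.2.1 h.2.2))
  have h1 := stay v x hvx (C.refl _)
  have h2 := stay v y hvy (C.refl _)
  exact (hall' x hx h1).not_rel_of_nonedge hy hxy (C.trans (C.symm h1) h2)

open Classical in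
/-- The affected vertices. -/
noncomputable def affected (S : Finset (Fin I.n)) (C : Setoid (Fin I.n)) : Finset (Fin I.n) :=
  S.filter fun b => ¬ Unaffected S C b

theorem card_affected_le (S : Finset (Fin I.n)) (C : Setoid (Fin I.n)) :
    (affected S C).card ≤ 2 * I.costOn S C := by
  classical
  have hsub : affected S C ⊆ (I.mistakesOn S C).biUnion fun e => e.toFinset := by
    intro b hb
    obtain ⟨hbS, hbU⟩ := Finset.mem_filter.mp hb
    simp only [Unaffected, not_and, not_forall, not_not] at hbU
    obtain ⟨x, hx, hm⟩ := hbU hbS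
    exact Finset.mem_biUnion.mpr ⟨s(b, x), mem_mistakesOn.mpr ⟨hbS, hx, hm⟩, by simp⟩
  calc (affected S C).card ≤ _ := Finset.card_le_card hsub
    _ ≤ (I.mistakesOn S C).card * 2 := Finset.card_biUnion_le_card_mul _ _ _ fun e _ => by
        by_cases h : e.IsDiag
        · rw [Sym2.card_toFinset_of_isDiag e h]; omega
        · rw [Sym2.card_toFinset_of_not_isDiag e h]
    _ ≤ 2 * I.costOn S C := by
        have := card_mistakesOn_le S C
        omega

/-- The vertex bound for yes-instances without redundant vertices. -/
theorem card_core_le {S : Finset (Fin I.n)} {c : ℕ} (hyes : I.YesOn S)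
    (hred : ∀ v, ¬ I.Redundant S v) (hc : IsClosedGraph I.graph.fuzzy c) :
    (I.core S).card ≤ 30 * I.k ^ 2 * c ^ 2 := by
  classical
  obtain ⟨C, hC⟩ := hyes
  rcases (I.core S).eq_empty_or_nonempty with h0 | ⟨v₀, hv₀⟩
  · simp [h0]
  obtain ⟨b₀, hb₀, hb₀U, -⟩ := exists_affected_of_mem_core (C := C) hv₀
  simp only [Unaffected, not_and, not_forall, not_not] at hb₀U
  obtain ⟨x₀, hx₀, hm₀⟩ := hb₀U hb₀
  have hk : 1 ≤ I.k := by
    have h1 := card_mistakesOn_le S C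
    have h2 : 0 < (I.mistakesOn S C).card :=
      Finset.card_pos.mpr ⟨_, mem_mistakesOn.mpr ⟨hb₀, hx₀, hm₀⟩⟩
    omega
  -- A mistake is a pair of distinct vertices without a fuzzy edge, and such a pair has fewer than
  -- `c` common fuzzy neighbours.
  have hc0 : 1 ≤ c := Nat.one_le_of_lt (hc.card_lt hm₀.ne hm₀.not_fuzzy)
  set s := 2 * c + 3 * I.k with hs
  let E : Fin I.n → Finset (Fin I.n) := fun x =>
    if (realIn S C x).card ≤ s then realIn S C x else ∅
  have hsub : I.core S ⊆ affected S C ∪ (affected S C).biUnion E ∪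
      (affected S C).biUnion (ordinaryIn S C s) := by
    intro v hv
    simp only [Finset.mem_union, Finset.mem_biUnion]
    by_cases hvU : Unaffected S C v
    · by_cases hvs : NearSparse S C s v
      · obtain ⟨x, hx, hxU, hxv, hCxv, hle⟩ := hvs
        refine Or.inl (Or.inr ⟨x, Finset.mem_filter.mpr ⟨hx, hxU⟩, ?_⟩)
        simp only [E, if_pos hle]
        exact Finset.mem_filter.mpr ⟨core_subset S hv, hCxv, hxv⟩
      · obtain ⟨b, hb, hbU, hbv⟩ := exists_affected_of_mem_core (C := C) hv
        exact Or.inr ⟨b, Finset.mem_filter.mpr ⟨hb, hbU⟩,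
          Finset.mem_filter.mpr ⟨hv, hvU, hbv, hvs⟩⟩
    · exact Or.inl (Or.inl (Finset.mem_filter.mpr ⟨core_subset S hv, hvU⟩))
  have h1 := Finset.card_le_card hsub
  have h2 := Finset.card_union_le (affected S C ∪ (affected S C).biUnion E)
    ((affected S C).biUnion (ordinaryIn S C s))
  have h3 := Finset.card_union_le (affected S C) ((affected S C).biUnion E)
  have h4 : ((affected S C).biUnion E).card ≤ (affected S C).card * s :=
    Finset.card_biUnion_le_card_mul _ _ _ fun x _ => by
      by_cases h : (realIn S C x).card ≤ s
      · simpa only [E, if_pos h] using h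
      · simp [E, if_neg h]
  have h5 : ((affected S C).biUnion (ordinaryIn S C s)).card ≤
      (affected S C).card * (c * s + 2 * c + 2 * I.k - 1) :=
    Finset.card_biUnion_le_card_mul _ _ _ fun b _ =>
      Nat.le_sub_one_of_lt (card_ordinaryIn_lt hc0 hC hred hc b)
  have h6 : (affected S C).card ≤ 2 * I.k := (card_affected_le S C).trans (by omega)
  have h7 : (I.core S).card ≤ 2 * I.k * (s + (c * s + 2 * c + 2 * I.k)) := by
    -- The `1` for the affected vertex itself cancels against the strictness of the bound on
    -- ordinary vertices.
    have h8 : (I.core S).card ≤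
        (affected S C).card * (1 + s + (c * s + 2 * c + 2 * I.k - 1)) := by
      rw [mul_add, mul_add, mul_one]; omega
    refine h8.trans (Nat.mul_le_mul h6 ?_)
    omega
  refine h7.trans ?_
  rw [hs]
  -- With `c = 1 + c'` and `k = 1 + k'` the inequality can be compared coefficientwise. The left
  -- side is in fact at most `28k²c²`.
  obtain ⟨c', rfl⟩ := Nat.exists_eq_add_of_le hc0
  obtain ⟨k', hk'⟩ := Nat.exists_eq_add_of_le hk
  rw [hk']
  ring_nf
  nlinarith [Nat.zero_le (k' ^ 2 * c' ^ 2), Nat.zero_le (k' ^ 2 * c'), Nat.zero_le (k' * c' ^ 2),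
    Nat.zero_le (k' * c'), Nat.zero_le (k' ^ 2), Nat.zero_le (c' ^ 2)]

end CCInstance

/-! ### A calculus for running times -/

@[simp] theorem Memory.setReg_reg (s : Memory) (r x q : ℕ) :
    (s.setReg r x).reg q = if q = r then x else s.reg q := by
  simp [Memory.setReg, Function.update_apply]

@[simp] theorem Memory.setReg_arr (s : Memory) (r x : ℕ) : (s.setReg r x).arr = s.arr := rfl

@[simp] theorem Memory.setArr_reg (s : Memory) (a i x : ℕ) : (s.setArr a i x).reg = s.reg := rfl

theorem Memory.setArr_arr (s : Memory) (a i x b j : ℕ) :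
    (s.setArr a i x).arr b j = if b = a ∧ j = i then x else s.arr b j := by
  by_cases hb : b = a
  · subst hb
    simp [Memory.setArr, Function.update_apply]
  · simp [Memory.setArr, hb]

theorem Memory.setArr_arr_of_ne (s : Memory) {a b : ℕ} (h : b ≠ a) (i x : ℕ) :
    (s.setArr a i x).arr b = s.arr b := by
  simp [Memory.setArr, h]

theorem eval_mono (P : Polynomial ℕ) {m n : ℕ} (h : m ≤ n) : P.eval m ≤ P.eval n := by
  rw [Polynomial.eval_eq_sum, Polynomial.eval_eq_sum]
  exact Finset.sum_le_sum fun i _ => Nat.mul_le_mul_left _ (Nat.pow_le_pow_left h i)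

/-- The program `p`, started in `s`, halts after at most `b` steps in a memory with property
`Q`. -/
def Runs (p : Program) (s : Memory) (b : ℕ) (Q : Memory → Prop) : Prop :=
  ∃ s' t, Exec p s s' t ∧ t ≤ b ∧ Q s'

theorem Runs.mono {p : Program} {s : Memory} {b b' : ℕ} {Q Q' : Memory → Prop}
    (h : Runs p s b Q) (hb : b ≤ b') (hQ : ∀ s', Q s' → Q' s') : Runs p s b' Q' := by
  obtain ⟨s', t, h1, h2, h3⟩ := h
  exact ⟨s', t, h1, h2.trans hb, hQ s' h3⟩

theorem Runs.seq {p q : Program} {s : Memory} {b₁ b₂ : ℕ} {Q : Memory → Prop}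
    (h : Runs p s b₁ fun s₁ => Runs q s₁ b₂ Q) : Runs (Program.seq p q) s (b₁ + b₂) Q := by
  obtain ⟨s₁, t₁, h1, h2, s₂, t₂, h3, h4, h5⟩ := h
  exact ⟨s₂, t₁ + t₂, Exec.seq h1 h3, Nat.add_le_add h2 h4, h5⟩

theorem Runs.assign {r : ℕ} {e : Expr} {s : Memory} {Q : Memory → Prop}
    (h : Q (s.setReg r (e.eval s))) : Runs (Program.assign r e) s (e.cost + 1) Q :=
  ⟨_, _, Exec.assign r e s, le_rfl, h⟩

theorem Runs.store {a : ℕ} {addr e : Expr} {s : Memory} {Q : Memory → Prop}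
    (h : Q (s.setArr a (addr.eval s) (e.eval s))) :
    Runs (Program.store a addr e) s (addr.cost + e.cost + 1) Q :=
  ⟨_, _, Exec.store a addr e s, le_rfl, h⟩

/-- The invariant is indexed by the round, and the number `N` of rounds is known beforehand. Total
correctness then follows by induction on the rounds still to come. -/
theorem Runs.loop {b : Expr} {p : Program} {β : ℕ} (P : ℕ → Memory → Prop) (N : ℕ)
    (hend : ∀ s, P N s → b.eval s = 0)
    (hstep : ∀ i < N, ∀ s, P i s → b.eval s ≠ 0 ∧ Runs p s β (P (i + 1)))
    {s : Memory} (hs : P 0 s) :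
    Runs (Program.loop b p) s (N * (b.cost + 1 + β) + (b.cost + 1)) (P N) := by
  suffices h : ∀ m ≤ N, ∀ s, P (N - m) s →
      Runs (Program.loop b p) s (m * (b.cost + 1 + β) + (b.cost + 1)) (P N) from
    h N le_rfl s (by rwa [Nat.sub_self])
  intro m
  induction m with
  | zero =>
    intro _ s hs
    exact ⟨s, _, Exec.loop_false (hend s hs), by omega, hs⟩
  | succ m ih =>
    intro hm s hs
    obtain ⟨hb, s₁, t₁, h1, h2, h3⟩ := hstep (N - (m + 1)) (by omega) s hs
    rw [show N - (m + 1) + 1 = N - m by omega] at h3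
    obtain ⟨s₂, t₂, h4, h5, h6⟩ := ih (by omega) s₁ h3
    refine ⟨s₂, _, Exec.loop_true hb h1 h4, ?_, h6⟩
    rw [Nat.succ_mul]
    omega

/-! ### Terms with sums over all numbers below the content of register `0` -/

/-- Arithmetic terms. A sum binds its register; the first factor of a product is truncated at the
content of register `0`, so that the evaluation time depends only on this content. -/
inductive Tm where
  | const (m : ℕ)
  | reg (r : ℕ)
  | get (a : ℕ) (t : Tm)
  | add (t u : Tm)
  | sub (t u : Tm)
  | mul (t u : Tm)
  | sum (r : ℕ) (t : Tm)

namespace Tm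

def eval : Tm → Memory → ℕ
  | const m, _ => m
  | reg r, s => s.reg r
  | get a t, s => s.arr a (t.eval s)
  | add t u, s => t.eval s + u.eval s
  | sub t u, s => t.eval s - u.eval s
  | mul t u, s => min (t.eval s) (s.reg 0) * u.eval s
  | sum r t, s => ∑ x ∈ Finset.range (s.reg 0), t.eval (s.setReg r x)

/-- All registers of the term are below `d`, and register `0` is not bound. -/
def Below : Tm → ℕ → Prop
  | const _, d => 0 < d
  | reg r, d => r < d
  | get _ t, d => t.Below d
  | add t u, d => t.Below d ∧ u.Below d
  | sub t u, d => t.Below d ∧ u.Below d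
  | mul t u, d => t.Below d ∧ u.Below d
  | sum r t, d => r ≠ 0 ∧ r < d ∧ t.Below d

/-- Code that evaluates a term into register `d`, with the registers above `d` as scratch. -/
def compile : Tm → ℕ → Program
  | const m, d => .assign d (.const m)
  | reg r, d => .assign d (.reg r)
  | get a t, d => .seq (t.compile d) (.assign d (.get a (.reg d)))
  | add t u, d => .seq (t.compile d) (.seq (u.compile (d + 1))
      (.assign d (.add (.reg d) (.reg (d + 1)))))
  | sub t u, d => .seq (t.compile d) (.seq (u.compile (d + 1))
      (.assign d (.sub (.reg d) (.reg (d + 1)))))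
  | mul t u, d => .seq (t.compile (d + 1)) (.seq (u.compile (d + 2)) (.seq
      (.assign d (.const 0)) (.seq
      (.assign (d + 1) (.sub (.reg 0) (.sub (.reg 0) (.reg (d + 1)))))
      (.loop (.reg (d + 1)) (.seq
        (.assign d (.add (.reg d) (.reg (d + 2))))
        (.assign (d + 1) (.sub (.reg (d + 1)) (.const 1))))))))
  | sum r t, d => .seq (.assign (d + 1) (.reg r)) (.seq (.assign d (.const 0)) (.seq
      (.assign r (.const 0)) (.seq
      (.loop (.sub (.reg 0) (.reg r)) (.seq (t.compile (d + 2)) (.seq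
        (.assign d (.add (.reg d) (.reg (d + 2))))
        (.assign r (.add (.reg r) (.const 1))))))
      (.assign r (.reg (d + 1))))))

/-- A bound for the running time in terms of the content of register `0`. -/
noncomputable def time : Tm → Polynomial ℕ
  | const _ => 2
  | reg _ => 2
  | get _ t => t.time + 3
  | add t u => t.time + (u.time + 4)
  | sub t u => t.time + (u.time + 4)
  | mul t u => t.time + (u.time + (2 + (6 + (Polynomial.X * 10 + 2))))
  | sum _ t => 2 + (2 + (2 + ((Polynomial.X * (4 + (t.time + 8)) + 4) + 2)))

/-- Scratch registers do not influence the value, so a second subterm evaluates the same after the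
code of the first has run. -/
theorem eval_congr {t : Tm} {d : ℕ} (ht : t.Below d) {s s' : Memory} (hd : 0 < d)
    (harr : s'.arr = s.arr) (hreg : ∀ r < d, s'.reg r = s.reg r) : t.eval s' = t.eval s := by
  induction t generalizing s s' with
  | const m => rfl
  | reg r => exact hreg r ht
  | get a t ih => simp only [eval, ih ht harr hreg, harr]
  | add t u iht ihu => simp only [eval, iht ht.1 harr hreg, ihu ht.2 harr hreg]
  | sub t u iht ihu => simp only [eval, iht ht.1 harr hreg, ihu ht.2 harr hreg]
  | mul t u iht ihu => simp only [eval, iht ht.1 harr hreg, ihu ht.2 harr hreg, hreg 0 hd]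
  | sum r t ih =>
    simp only [eval, hreg 0 hd]
    refine Finset.sum_congr rfl fun x _ => ih ht.2.2 harr fun q hq => ?_
    simp only [Memory.setReg_reg, hreg q hq]

/-- Equality of arrays and of the registers below `d`. -/
def _root_.CorrelationClustering.Memory.Agree (d : ℕ) (s' s : Memory) : Prop :=
  s'.arr = s.arr ∧ ∀ r < d, s'.reg r = s.reg r

theorem Below.mono {t : Tm} {d e : ℕ} (h : t.Below d) (hde : d ≤ e) : t.Below e := by
  induction t with
  | const m => exact lt_of_lt_of_le h hde
  | reg r => exact lt_of_lt_of_le h hde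
  | get a t ih => exact ih h
  | add t u iht ihu => exact ⟨iht h.1, ihu h.2⟩
  | sub t u iht ihu => exact ⟨iht h.1, ihu h.2⟩
  | mul t u iht ihu => exact ⟨iht h.1, ihu h.2⟩
  | sum r t ih => exact ⟨h.1, h.2.1.trans_le hde, ih h.2.2⟩

/-- The registers from `d` on work as a stack for intermediate values. A sum uses its bound register
as the loop counter, so it saves the old content in register `d + 1` and restores it at the end. -/
theorem runs_compile {t : Tm} {d : ℕ} (ht : t.Below d) (hd : 0 < d) (s : Memory) :
    Runs (t.compile d) s (t.time.eval (s.reg 0)) fun s' =>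
      s'.Agree d s ∧ s'.reg d = t.eval s := by
  induction t generalizing d s with
  | const m =>
    refine Runs.mono (Runs.assign ?_) (by simp [Expr.cost, time]) fun _ => id
    refine ⟨⟨rfl, fun r hr => ?_⟩, ?_⟩
    · simp [hr.ne]
    · simp [Expr.eval, eval]
  | reg r =>
    refine Runs.mono (Runs.assign ?_) (by simp [Expr.cost, time]) fun _ => id
    refine ⟨⟨rfl, fun r hr => ?_⟩, ?_⟩
    · simp [hr.ne]
    · simp [Expr.eval, eval]
  | get a t ih =>
    refine Runs.mono (Runs.seq ((ih ht hd s).mono le_rfl fun s₁ h₁ => Runs.assign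
      (Q := fun s' => s'.Agree d s ∧ s'.reg d = (get a t).eval s) ?_))
      (by simp [Expr.cost, time]) fun _ => id
    obtain ⟨⟨ha, hr⟩, h⟩ := h₁
    refine ⟨⟨ha, fun r hrd => ?_⟩, ?_⟩
    · simp [hrd.ne, hr r hrd]
    · simp [Expr.eval, eval, h, ha]
  | add t u iht ihu =>
    refine Runs.mono (Runs.seq ((iht ht.1 hd s).mono le_rfl fun s₁ h₁ => Runs.seq
      ((ihu (ht.2.mono (Nat.le_succ d)) (Nat.succ_pos d) s₁).mono
      (b' := u.time.eval (s.reg 0)) (by rw [h₁.1.2 0 hd]) fun s₂ h₂ =>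
      Runs.assign (Q := fun s' => s'.Agree d s ∧ s'.reg d = (add t u).eval s) ?_)))
      (by simp [Expr.cost, time]) fun _ => id
    obtain ⟨⟨ha, hr⟩, h⟩ := h₁
    obtain ⟨⟨ha', hr'⟩, h'⟩ := h₂
    rw [eval_congr ht.2 hd ha hr] at h'
    refine ⟨⟨ha'.trans ha, fun r hrd => ?_⟩, ?_⟩
    · simp [hrd.ne, hr r hrd, hr' r (by omega)]
    · simp [Expr.eval, eval, h', hr' d (by omega), h]
  | sub t u iht ihu =>
    refine Runs.mono (Runs.seq ((iht ht.1 hd s).mono le_rfl fun s₁ h₁ => Runs.seq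
      ((ihu (ht.2.mono (Nat.le_succ d)) (Nat.succ_pos d) s₁).mono
      (b' := u.time.eval (s.reg 0)) (by rw [h₁.1.2 0 hd]) fun s₂ h₂ =>
      Runs.assign (Q := fun s' => s'.Agree d s ∧ s'.reg d = (sub t u).eval s) ?_)))
      (by simp [Expr.cost, time]) fun _ => id
    obtain ⟨⟨ha, hr⟩, h⟩ := h₁
    obtain ⟨⟨ha', hr'⟩, h'⟩ := h₂
    rw [eval_congr ht.2 hd ha hr] at h'
    refine ⟨⟨ha'.trans ha, fun r hrd => ?_⟩, ?_⟩
    · simp [hrd.ne, hr r hrd, hr' r (by omega)]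
    · simp [Expr.eval, eval, h', hr' d (by omega), h]
  | mul t u iht ihu =>
    set N := min (t.eval s) (s.reg 0) with hN
    have hloop : ∀ s₀ : Memory, s₀.Agree d s → s₀.reg d = 0 → s₀.reg (d + 1) = N →
        s₀.reg (d + 2) = u.eval s →
        Runs (.loop (.reg (d + 1)) (.seq (.assign d (.add (.reg d) (.reg (d + 2))))
          (.assign (d + 1) (.sub (.reg (d + 1)) (.const 1))))) s₀ (s.reg 0 * 10 + 2)
          fun s' => s'.Agree d s ∧ s'.reg d = (mul t u).eval s := by
      intro s₀ h0 h1 h2 h3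
      refine Runs.mono (Runs.loop (β := 8) (fun i s' => s'.Agree d s ∧
        s'.reg d = i * u.eval s ∧ s'.reg (d + 1) = N - i ∧ s'.reg (d + 2) = u.eval s) N ?_ ?_ ?_)
        ?_ ?_
      · rintro s' ⟨-, -, h, -⟩
        simp [Expr.eval, h]
      · rintro i hi s' ⟨⟨ha, hr⟩, h4, h5, h6⟩
        refine ⟨by simp only [Expr.eval, h5]; omega, Runs.seq (b₁ := 4) (b₂ := 4) ?_⟩
        refine Runs.assign (Runs.assign ⟨⟨ha, fun r hrd => ?_⟩, ?_, ?_, ?_⟩)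
        · simp [hrd.ne, hr r hrd, show r ≠ d + 1 by omega]
        · simp [Expr.eval, h4, h6, Nat.succ_mul]
        · simp [Expr.eval, h5]; omega
        · simp [h6]
      · exact ⟨h0, by simp [h1], by simp [h2], h3⟩
      · have : N ≤ s.reg 0 := min_le_right _ _
        simp only [Expr.cost]
        omega
      · rintro s' ⟨h4, h5, -⟩
        exact ⟨h4, h5⟩
    refine Runs.mono (Runs.seq ((iht (ht.1.mono (Nat.le_succ d)) (Nat.succ_pos d) s).mono le_rfl
      fun s₁ h₁ => Runs.seq ((ihu (ht.2.mono (Nat.le_add_right d 2)) (Nat.succ_pos _) s₁).mono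
      (b' := u.time.eval (s.reg 0)) (by rw [h₁.1.2 0 (by omega)]) fun s₂ h₂ => Runs.seq <|
      Runs.assign (Runs.seq (Runs.assign (hloop _ ?_ ?_ ?_ ?_))))))
      (by simp [Expr.cost, time]) fun _ => id
    all_goals
      obtain ⟨⟨ha, hr⟩, h⟩ := h₁
      obtain ⟨⟨ha', hr'⟩, h'⟩ := h₂
      rw [eval_congr ht.2 hd ha fun r hrd => hr r (by omega)] at h'
    · refine ⟨ha'.trans ha, fun r hrd => ?_⟩
      simp [hrd.ne, show r ≠ d + 1 by omega, hr r (by omega), hr' r (by omega)]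
    · simp [Expr.eval]
    · have e0 : s₂.reg 0 = s.reg 0 := by rw [hr' 0 (by omega), hr 0 (by omega)]
      have e1 : s₂.reg (d + 1) = t.eval s := by rw [hr' _ (by omega), h]
      -- With truncated subtraction, `x - (x - y)` is the minimum of `x` and `y`; this bounds the
      -- rounds of the multiplication loop by the content of register `0`.
      simp only [Expr.eval, Memory.setReg_reg, e0, e1, hN]
      simp [hd.ne]
      omega
    · simp [h']
  | sum r t ih =>
    obtain ⟨hr0, hrd, ht⟩ := ht
    have hloop : ∀ s₀ : Memory, s₀.arr = s.arr → (∀ q < d, q ≠ r → s₀.reg q = s.reg q) →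
        s₀.reg r = 0 → s₀.reg d = 0 → s₀.reg (d + 1) = s.reg r →
        Runs (.loop (.sub (.reg 0) (.reg r)) (.seq (t.compile (d + 2)) (.seq
          (.assign d (.add (.reg d) (.reg (d + 2))))
          (.assign r (.add (.reg r) (.const 1)))))) s₀
          (s.reg 0 * (4 + (t.time.eval (s.reg 0) + 8)) + 4) fun s' => s'.arr = s.arr ∧
            (∀ q < d, q ≠ r → s'.reg q = s.reg q) ∧ s'.reg (d + 1) = s.reg r ∧
            s'.reg d = (sum r t).eval s := by
      intro s₀ h1 h2 h3 h4 h5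
      refine Runs.mono (Runs.loop (β := t.time.eval (s.reg 0) + 8) (fun i s' => s'.arr = s.arr ∧
        (∀ q < d, q ≠ r → s'.reg q = s.reg q) ∧ s'.reg (d + 1) = s.reg r ∧ s'.reg r = i ∧
        s'.reg d = ∑ x ∈ Finset.range i, t.eval (s.setReg r x)) (s.reg 0) ?_ ?_ ?_) ?_ ?_
      · rintro s' ⟨-, hq, -, h, -⟩
        simp [Expr.eval, h, hq 0 hd hr0.symm]
      · rintro i hi s' ⟨ha, hq, h6, h7, h8⟩
        have e0 : s'.reg 0 = s.reg 0 := hq 0 hd hr0.symm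
        refine ⟨by simp only [Expr.eval, h7, e0]; omega, ?_⟩
        refine Runs.seq ((ih (ht.mono (Nat.le_add_right d 2)) (Nat.succ_pos _) s').mono
          (by rw [e0]) ?_)
        rintro s₁ ⟨⟨ha', hr'⟩, h'⟩
        rw [eval_congr (s := s.setReg r i) ht hd ha fun q hqd => by
          by_cases hqr : q = r
          · simp [hqr, h7]
          · simp [hqr, hq q hqd hqr]] at h'
        refine Runs.seq (b₁ := 4) (b₂ := 4) (Runs.assign (Runs.assign ⟨ha'.trans ha,
          fun q hqd hqr => ?_, ?_, ?_, ?_⟩))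
        · simp [hqr, hqd.ne, hr' q (by omega), hq q hqd hqr]
        · simp [show d + 1 ≠ r by omega, hr' (d + 1) (by omega), h6]
        · simp [Expr.eval, hrd.ne, hr' r (by omega), h7]
        · simp [Expr.eval, hrd.ne', hr' d (by omega), h', h8, Finset.sum_range_succ]
      · exact ⟨h1, h2, h5, h3, by simp [h4]⟩
      · simp [Expr.cost]
      · rintro s' ⟨h6, h7, h8, -, h9⟩
        exact ⟨h6, h7, h8, h9⟩
    refine Runs.mono (Runs.seq (Runs.assign (Runs.seq (Runs.assign (Runs.seq (Runs.assign
      (Runs.seq ((hloop _ ?_ ?_ ?_ ?_ ?_).mono le_rfl fun s₁ h₁ => Runs.assign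
      (Q := fun s' => s'.Agree d s ∧ s'.reg d = (sum r t).eval s) ?_))))))))
      (by simp [Expr.cost, time]) fun _ => id
    · rfl
    · intro q hqd hqr
      simp [hqr, hqd.ne, show q ≠ d + 1 by omega]
    · simp [Expr.eval]
    · simp [Expr.eval, hrd.ne']
    · simp [Expr.eval, show d + 1 ≠ r by omega]
    · obtain ⟨ha, hq, h1, h2⟩ := h₁
      refine ⟨⟨ha, fun q hqd => ?_⟩, ?_⟩
      · by_cases hqr : q = r
        · simp [hqr, Expr.eval, h1]
        · simp [hqr, hq q hqd hqr]
      · simp [hrd.ne', h2]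

end Tm

/-! ### Statements with loops over all numbers below the content of register `0` -/

inductive Stmt where
  | assign (r : ℕ) (t : Tm)
  | store (a : ℕ) (addr t : Tm)
  | seq (p q : Stmt)
  | cond (b : Tm) (p q : Stmt)
  | loop (r : ℕ) (p : Stmt)

namespace Stmt

/-- The final memory. -/
def run : Stmt → Memory → Memory
  | assign r t, s => s.setReg r (t.eval s)
  | store a addr t, s => s.setArr a (addr.eval s) (t.eval s)
  | seq p q, s => q.run (p.run s)
  | cond b p q, s => if b.eval s ≠ 0 then p.run s else q.run s
  | loop r p, s => Nat.rec s (fun i s' => p.run (s'.setReg r i)) (s.reg 0)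

/-- All registers are below `d`, and register `0` is only read. -/
def Below : Stmt → ℕ → Prop
  | assign r t, d => r ≠ 0 ∧ r < d ∧ t.Below d
  | store _ addr t, d => addr.Below d ∧ t.Below d
  | seq p q, d => p.Below d ∧ q.Below d
  | cond b p q, d => b.Below d ∧ p.Below d ∧ q.Below d
  | loop r p, d => r ≠ 0 ∧ r < d ∧ p.Below d

/-- Code for a statement, with the registers from `d` on as scratch. -/
def compile : Stmt → ℕ → Program
  | assign r t, d => .seq (t.compile d) (.assign r (.reg d))
  | store a addr t, d => .seq (addr.compile d) (.seq (t.compile (d + 1))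
      (.store a (.reg d) (.reg (d + 1))))
  | seq p q, d => .seq (p.compile d) (q.compile d)
  | cond b p q, d => .seq (b.compile d) (.cond (.reg d) (p.compile d) (q.compile d))
  | loop r p, d => .seq (.assign d (.const 0)) (.loop (.sub (.reg 0) (.reg d)) (.seq
      (.assign r (.reg d)) (.seq (p.compile (d + 1)) (.assign d (.add (.reg d) (.const 1))))))

noncomputable def time : Stmt → Polynomial ℕ
  | assign _ t => t.time + 2
  | store _ addr t => addr.time + (t.time + 3)
  | seq p q => p.time + q.time
  | cond b p q => b.time + (2 + (p.time + q.time))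
  | loop _ p => 2 + (Polynomial.X * (4 + (2 + (p.time + 4))) + 4)

theorem run_reg_zero {p : Stmt} {d : ℕ} (h : p.Below d) (s : Memory) :
    (p.run s).reg 0 = s.reg 0 := by
  induction p generalizing s with
  | assign r t => simp [run, h.1.symm]
  | store a addr t => rfl
  | seq p q ihp ihq => exact (ihq h.2 _).trans (ihp h.1 s)
  | cond b p q ihp ihq =>
    simp only [run]
    split_ifs
    · exact ihp h.2.1 s
    · exact ihq h.2.2 s
  | loop r p ih =>
    have key : ∀ N, (Nat.rec (motive := fun _ => Memory) s
        (fun i s' => p.run (s'.setReg r i)) N).reg 0 = s.reg 0 := by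
      intro N
      induction N with
      | zero => rfl
      | succ N ihN =>
        simp only
        rw [ih h.2.2, Memory.setReg_reg, if_neg h.1.symm, ihN]
    exact key _

/-- The registers from `d` to `e - 1` contain the counters of the enclosing loops and must survive.
Each loop counts in register `e` and only copies the counter to `r`, so the body is free to
overwrite `r`. -/
theorem runs_compile {p : Stmt} {d e : ℕ} (hp : p.Below d) (hd : 0 < d) (hde : d ≤ e)
    {s s₀ : Memory} (hs : s.Agree d s₀) :
    Runs (p.compile e) s (p.time.eval (s₀.reg 0)) fun s' =>
      s'.Agree d (p.run s₀) ∧ ∀ q, d ≤ q → q < e → s'.reg q = s.reg q := by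
  induction p generalizing e s s₀ with
  | assign r t =>
    obtain ⟨hr0, hrd, ht⟩ := hp
    refine Runs.mono (Runs.seq ((Tm.runs_compile (ht.mono hde) (hd.trans_le hde) s).mono
      (b' := t.time.eval (s₀.reg 0)) (by rw [hs.2 0 hd]) fun s₁ h₁ => Runs.assign
      (Q := fun s' => s'.Agree d ((assign r t).run s₀) ∧
        ∀ q, d ≤ q → q < e → s'.reg q = s.reg q) ?_)) (by simp [Expr.cost, time]) fun _ => id
    obtain ⟨⟨ha, hr⟩, h⟩ := h₁
    rw [Tm.eval_congr ht hd hs.1 hs.2] at h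
    refine ⟨⟨ha.trans hs.1, fun q hq => ?_⟩, fun q h1 h2 => ?_⟩
    · simp [run, Expr.eval, h, hr q (by omega), hs.2 q hq]
    · simp [hr q h2, show q ≠ r by omega]
  | store a addr t =>
    refine Runs.mono (Runs.seq ((Tm.runs_compile (hp.1.mono hde) (hd.trans_le hde) s).mono
      (b' := addr.time.eval (s₀.reg 0)) (by rw [hs.2 0 hd]) fun s₁ h₁ => Runs.seq
      ((Tm.runs_compile (hp.2.mono (hde.trans (Nat.le_succ e))) (Nat.succ_pos e) s₁).mono
      (b' := t.time.eval (s₀.reg 0)) (by rw [h₁.1.2 0 (by omega), hs.2 0 hd]) fun s₂ h₂ =>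
      Runs.store (Q := fun s' => s'.Agree d ((store a addr t).run s₀) ∧
        ∀ q, d ≤ q → q < e → s'.reg q = s.reg q) ?_)))
      (by simp [Expr.cost, time]) fun _ => id
    obtain ⟨⟨ha, hr⟩, h⟩ := h₁
    obtain ⟨⟨ha', hr'⟩, h'⟩ := h₂
    rw [Tm.eval_congr hp.2 hd (ha.trans hs.1) fun q hq =>
      (hr q (by omega)).trans (hs.2 q hq)] at h'
    rw [Tm.eval_congr hp.1 hd hs.1 hs.2] at h
    refine ⟨⟨?_, fun q hq => ?_⟩, fun q h1 h2 => ?_⟩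
    · simp only [run, Expr.eval, h', hr' e (Nat.lt_succ_self e), h, Memory.setArr, ha', ha, hs.1]
    · simp [run, hr' q (by omega), hr q (by omega), hs.2 q hq]
    · simp [hr' q (by omega), hr q h2]
  | seq p q ihp ihq =>
    refine Runs.mono (Runs.seq ((ihp hp.1 hde hs).mono le_rfl fun s₁ h₁ =>
      (ihq hp.2 hde h₁.1).mono (b' := q.time.eval (s₀.reg 0)) (by rw [run_reg_zero hp.1])
      (Q' := fun s' => s'.Agree d ((seq p q).run s₀) ∧
        ∀ q, d ≤ q → q < e → s'.reg q = s.reg q)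
      fun s₂ h₂ => ⟨h₂.1, fun q h1 h2 => (h₂.2 q h1 h2).trans (h₁.2 q h1 h2)⟩))
      (by simp [time]) fun _ => id
  | cond b p q ihp ihq =>
    refine Runs.mono (Runs.seq (b₂ := 2 + (p.time.eval (s₀.reg 0) + q.time.eval (s₀.reg 0)))
      (Q := fun s' => s'.Agree d ((cond b p q).run s₀) ∧
        ∀ q, d ≤ q → q < e → s'.reg q = s.reg q)
      ((Tm.runs_compile (hp.1.mono hde) (hd.trans_le hde) s).mono
      (b' := b.time.eval (s₀.reg 0)) (by rw [hs.2 0 hd]) fun s₁ h₁ => ?_))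
      (by simp [time]) fun _ => id
    obtain ⟨⟨ha, hr⟩, h⟩ := h₁
    rw [Tm.eval_congr hp.1 hd hs.1 hs.2] at h
    have hs₁ : s₁.Agree d s₀ :=
      ⟨ha.trans hs.1, fun q hq => (hr q (by omega)).trans (hs.2 q hq)⟩
    by_cases hb : b.eval s₀ ≠ 0
    · obtain ⟨s', t, h1, h2, h3, h4⟩ := ihp hp.2.1 hde hs₁
      refine ⟨s', _, Exec.cond_true (by rwa [Expr.eval, h]) h1, ?_, ?_,
        fun q hq hq' => (h4 q hq hq').trans (hr q hq')⟩
      · simp only [Expr.cost]; omega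
      · simpa only [run, if_pos hb] using h3
    · obtain ⟨s', t, h1, h2, h3, h4⟩ := ihq hp.2.2 hde hs₁
      refine ⟨s', _, Exec.cond_false (by rw [Expr.eval, h]; exact not_not.mp hb) h1, ?_, ?_,
        fun q hq hq' => (h4 q hq hq').trans (hr q hq')⟩
      · simp only [Expr.cost]; omega
      · simpa only [run, if_neg hb] using h3
  | loop r p ih =>
    obtain ⟨hr0, hrd, hp⟩ := hp
    let σ : ℕ → Memory := fun i => Nat.rec s₀ (fun i s' => p.run (s'.setReg r i)) i
    have hσ0 : ∀ i, (σ i).reg 0 = s₀.reg 0 := by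
      intro i
      induction i with
      | zero => rfl
      | succ i ihi =>
        change (p.run ((σ i).setReg r i)).reg 0 = _
        rw [run_reg_zero hp, Memory.setReg_reg, if_neg hr0.symm, ihi]
    refine Runs.mono (Runs.seq (Runs.assign (Runs.loop
      (β := 2 + (p.time.eval (s₀.reg 0) + 4))
      (fun i s' => s'.Agree d (σ i) ∧ s'.reg e = i ∧
        ∀ q, d ≤ q → q < e → s'.reg q = s.reg q) (s₀.reg 0) ?_ ?_ ?_))) ?_ ?_
    · rintro s' ⟨h1, h2, -⟩
      simp [Expr.eval, h2, h1.2 0 hd, hσ0]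
    · rintro i hi s' ⟨h1, h2, h3⟩
      refine ⟨by simp only [Expr.eval, h2, h1.2 0 hd, hσ0]; omega, ?_⟩
      have hag : (s'.setReg r i).Agree d ((σ i).setReg r i) :=
        ⟨h1.1, fun q hq => by simp [h1.2 q hq]⟩
      refine Runs.seq (Runs.assign ?_)
      rw [show (Expr.reg e).eval s' = i from h2]
      refine Runs.seq ((ih hp (hde.trans (Nat.le_succ e)) hag).mono
        (by rw [Memory.setReg_reg, if_neg hr0.symm, hσ0]) ?_)
      rintro s₁ ⟨⟨ha, hr⟩, h4⟩
      have h5 : s₁.reg e = i := by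
        rw [h4 e hde (Nat.lt_succ_self e), Memory.setReg_reg, if_neg (by omega), h2]
      refine Runs.assign ⟨⟨ha, fun q hq => ?_⟩, ?_, fun q hq hqe => ?_⟩
      · rw [Memory.setReg_reg, if_neg (by omega), hr q hq]
      · simp [Expr.eval, h5]
      · rw [Memory.setReg_reg, if_neg hqe.ne, h4 q hq (by omega), Memory.setReg_reg,
          if_neg (by omega), h3 q hq hqe]
    · refine ⟨⟨hs.1, fun q hq => ?_⟩, ?_, fun q _ hqe => ?_⟩
      · simp [show q ≠ e by omega, hs.2 q hq, σ]
      · simp [Expr.eval]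
      · simp [hqe.ne]
    · simp [Expr.cost, time]
    · rintro s' ⟨h1, -, h2⟩
      exact ⟨h1, h2⟩

/-- The invariant rule for loops. -/
theorem run_loop {r : ℕ} {p : Stmt} {s : Memory} (P : ℕ → Memory → Prop) (h0 : P 0 s)
    (hstep : ∀ i < s.reg 0, ∀ s', P i s' → P (i + 1) (p.run (s'.setReg r i))) :
    P (s.reg 0) ((loop r p).run s) := by
  have key : ∀ N ≤ s.reg 0, P N (Nat.rec (motive := fun _ => Memory) s
      (fun i s' => p.run (s'.setReg r i)) N) := by
    intro N
    induction N with
    | zero => exact fun _ => h0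
    | succ N ih => exact fun h => hstep N h _ (ih (Nat.le_of_succ_le h))
  exact key _ le_rfl

end Stmt

/-! ### Induced instances and a fixed no-instance -/

theorem IsClosedGraph.comap {V W : Type*} [Finite V] {H : SimpleGraph V} {c : ℕ}
    (h : IsClosedGraph H c) (f : W ↪ V) : IsClosedGraph (H.comap f) c := by
  intro u v huv hadj
  refine lt_of_le_of_lt ?_ (h (f u) (f v) (f.injective.ne huv) hadj)
  rw [← Set.ncard_image_of_injective _ f.injective]
  refine Set.ncard_le_ncard ?_ (Set.toFinite _)
  rintro _ ⟨w, hw, rfl⟩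
  exact hw

theorem graphClosure_le {V : Type*} {H : SimpleGraph V} {c : ℕ} (h : IsClosedGraph H c) :
    graphClosure H ≤ c := Nat.sInf_le h

theorem nat_size_le (m : ℕ) : Nat.size m ≤ m := Nat.size_le.mpr Nat.lt_two_pow_self

/-- One truncated summand already exceeds the budget, so no truncation occurs in a sum of at most
`k`. -/
theorem sum_min_le_iff {α : Type*} (s : Finset α) (w : α → ℕ) (k : ℕ) :
    ∑ e ∈ s, min (w e) (k + 1) ≤ k ↔ ∑ e ∈ s, w e ≤ k := by
  refine ⟨fun h => ?_, fun h => (Finset.sum_le_sum fun e _ => min_le_left _ _).trans h⟩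
  refine le_trans (Finset.sum_le_sum fun e he => ?_) h
  have := (Finset.single_le_sum (f := fun e => min (w e) (k + 1)) (fun _ _ => Nat.zero_le _)
    he).trans h
  omega

namespace CCInstance

variable (I : CCInstance)

/-- The increasing enumeration of a set of vertices. -/
noncomputable def enum (A : Finset (Fin I.n)) : Fin A.card ↪ Fin I.n :=
  (A.orderEmbOfFin rfl).toEmbedding

/-- The instance induced by a set of vertices, with weights truncated at `k + 1`. -/
noncomputable def induce (A : Finset (Fin I.n)) : CCInstance where
  n := A.card
  graph :=
    { real := I.graph.real.comap (I.enum A)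
      fuzzy := I.graph.fuzzy.comap (I.enum A)
      disjoint := by
        rw [SimpleGraph.disjoint_left]
        exact fun u v h => not_fuzzy_of_real (I := I) h }
  weight e := min (I.weight (e.map (I.enum A))) (I.k + 1)
  weight_diag v := by simp [I.weight_diag]
  weight_eq_zero_iff u v huv := by
    have := I.weight_eq_zero_iff _ _ ((I.enum A).injective.ne huv)
    rw [SimpleGraph.comap_adj, ← this]
    simp
  k := I.k

/-- The embedding of the vertices of an induced instance. -/
noncomputable def emb (A : Finset (Fin I.n)) : Fin (I.induce A).n ↪ Fin I.n := I.enum A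

variable {I}

theorem emb_val_lt_iff {A : Finset (Fin I.n)} {i j : Fin (I.induce A).n} :
    I.emb A i < I.emb A j ↔ i < j :=
  (A.orderEmbOfFin rfl).lt_iff_lt (a := i) (b := j)

theorem emb_mem {A : Finset (Fin I.n)} (i : Fin (I.induce A).n) : I.emb A i ∈ A :=
  A.orderEmbOfFin_mem rfl i

theorem exists_emb_eq {A : Finset (Fin I.n)} {v : Fin I.n} (hv : v ∈ A) :
    ∃ i, I.emb A i = v := by
  have : v ∈ Set.range (A.orderEmbOfFin rfl) := by
    rw [Finset.range_orderEmbOfFin]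
    exact hv
  exact this

/-- This makes the new number of a vertex computable: it is the number of smaller selected vertices.
-/
theorem card_filter_lt_emb {A : Finset (Fin I.n)} (i : Fin (I.induce A).n) :
    (A.filter fun v => v < I.emb A i).card = i := by
  classical
  have : (A.filter fun v => v < I.emb A i) = (Finset.Iio i).map (I.emb A) := by
    ext v
    simp only [Finset.mem_filter, Finset.mem_map, Finset.mem_Iio]
    constructor
    · rintro ⟨hv, hlt⟩
      obtain ⟨j, rfl⟩ := exists_emb_eq hv
      exact ⟨j, emb_val_lt_iff.mp hlt, rfl⟩
    · rintro ⟨j, hj, rfl⟩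
      exact ⟨emb_mem j, emb_val_lt_iff.mpr hj⟩
  rw [this, Finset.card_map, Fin.card_Iio]

theorem mistake_induce {A : Finset (Fin I.n)} {C : Setoid (Fin I.n)} {i j : Fin (I.induce A).n} :
    (I.induce A).Mistake (C.comap (I.emb A)) i j ↔ I.Mistake C (I.emb A i) (I.emb A j) := by
  have h : (I.induce A).graph.nonedge.Adj i j ↔
      I.graph.nonedge.Adj (I.emb A i) (I.emb A j) := by
    rw [nonedge_adj, nonedge_adj]
    rw [(I.emb A).injective.ne_iff]
    rfl
  unfold Mistake
  rw [h]
  rfl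

theorem costOn_induce_le_iff (A : Finset (Fin I.n)) (C : Setoid (Fin I.n)) :
    (I.induce A).costOn Finset.univ (C.comap (I.emb A)) ≤ I.k ↔ I.costOn A C ≤ I.k := by
  have hinj : Function.Injective (Sym2.map (I.emb A)) := Sym2.map.injective (I.emb A).injective
  have himg : I.mistakesOn A C = ((I.induce A).mistakesOn Finset.univ
      (C.comap (I.emb A))).map ⟨Sym2.map (I.emb A), hinj⟩ := by
    ext e
    induction e with
    | _ u v =>
      rw [mem_mistakesOn, Finset.mem_map]
      constructor
      · rintro ⟨hu, hv, h⟩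
        obtain ⟨i, rfl⟩ := exists_emb_eq hu
        obtain ⟨j, rfl⟩ := exists_emb_eq hv
        exact ⟨s(i, j), mem_mistakesOn.mpr
          ⟨Finset.mem_univ _, Finset.mem_univ _, mistake_induce.mpr h⟩, rfl⟩
      · rintro ⟨e, he, heq⟩
        induction e with
        | _ i j =>
          have h := mistake_induce.mp (mem_mistakesOn.mp he).2.2
          simp only [Function.Embedding.coeFn_mk, Sym2.map_mk, Sym2.eq_iff] at heq
          rcases heq with ⟨rfl, rfl⟩ | ⟨rfl, rfl⟩
          · exact ⟨emb_mem _, emb_mem _, h⟩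
          · exact ⟨emb_mem _, emb_mem _, h.symm⟩
  rw [costOn, costOn, himg, Finset.sum_map]
  exact sum_min_le_iff _ _ _

theorem isYes_induce_iff (A : Finset (Fin I.n)) : (I.induce A).IsYes ↔ I.YesOn A := by
  rw [isYes_iff_yesOn]
  constructor
  · rintro ⟨D, hD⟩
    -- All vertices outside `A` share the dummy cluster `none`, which has no effect on the cost
    -- within `A`.
    let f : Fin I.n → Option (Quotient D) := fun v =>
      if h : ∃ i, I.emb A i = v then some (Quotient.mk D h.choose) else none
    have hf : ∀ i, f (I.emb A i) = some (Quotient.mk D i) := by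
      intro i
      have h : ∃ j, I.emb A j = I.emb A i := ⟨i, rfl⟩
      simp only [f, dif_pos h]
      rw [(I.emb A).injective h.choose_spec]
    refine ⟨Setoid.ker f, (costOn_induce_le_iff A _).mp ?_⟩
    have : (Setoid.ker f).comap (I.emb A) = D := by
      ext i j
      rw [Setoid.comap_rel, Setoid.ker_def, hf, hf, Option.some_inj]
      exact Quotient.eq
    rw [this]
    exact hD
  · rintro ⟨C, hC⟩
    exact ⟨_, (costOn_induce_le_iff A C).mpr hC⟩

theorem fuzzyClosure_induce_le (A : Finset (Fin I.n)) :
    (I.induce A).fuzzyClosure ≤ I.fuzzyClosure :=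
  graphClosure_le ((isClosedGraph_graphClosure I.graph.fuzzy).comap (I.emb A))

theorem size_le_of_weight_le (I : CCInstance) {m : ℕ} (h : ∀ e, I.weight e ≤ m) :
    I.size ≤ I.n ^ 2 + I.n + I.k + I.n ^ 2 * m := by
  have h1 : ∑ i : Fin I.n, ∑ j : Fin I.n, Nat.size (I.weight s(i, j)) ≤ I.n ^ 2 * m := by
    calc _ ≤ ∑ _i : Fin I.n, ∑ _j : Fin I.n, m :=
          Finset.sum_le_sum fun i _ => Finset.sum_le_sum fun j _ => (nat_size_le _).trans (h _)
      _ = I.n ^ 2 * m := by simp; ring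
  have := nat_size_le I.n
  have := nat_size_le I.k
  rw [size]
  omega

/-- A path with two real edges between the ends of a nonedge, and no budget. -/
def path : CCInstance where
  n := 3
  graph :=
    { real :=
        { Adj := fun x y => x.val + 1 = y.val ∨ y.val + 1 = x.val
          symm.symm := fun _ _ h => h.symm
          loopless.irrefl := fun _ h => by omega }
      fuzzy := ⊥
      disjoint := disjoint_bot_right }
  weight e := if e.IsDiag then 0 else 1
  weight_diag v := by simp
  weight_eq_zero_iff u v huv := by simp [huv]
  k := 0

theorem not_isYes_path : ¬ path.IsYes := by
  rw [isYes_iff_yesOn]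
  rintro ⟨C, hC⟩
  have h0 := card_mistakesOn_le Finset.univ C
  have h1 : path.mistakesOn Finset.univ C = ∅ := by
    rw [← Finset.card_eq_zero]
    have : path.k = 0 := rfl
    omega
  have h2 : ∀ u v, ¬ path.Mistake C u v := by
    intro u v h
    have := mem_mistakesOn.mpr ⟨Finset.mem_univ u, Finset.mem_univ v, h⟩
    rw [h1] at this
    exact absurd this (Finset.notMem_empty _)
  let a : Fin path.n := ⟨0, by decide⟩
  let b : Fin path.n := ⟨1, by decide⟩
  let c : Fin path.n := ⟨2, by decide⟩
  have hab : C a b := by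
    by_contra h
    exact h2 a b (Or.inl ⟨Or.inl rfl, h⟩)
  have hbc : C b c := by
    by_contra h
    exact h2 b c (Or.inl ⟨Or.inl rfl, h⟩)
  refine h2 a c (Or.inr ⟨nonedge_adj.mpr ⟨?_, ?_, id⟩, C.trans hab hbc⟩)
  · exact Fin.ne_of_val_ne (by decide)
  · rintro (h | h) <;> exact absurd h (by decide)

/-- The path is only output for instances with a real edge, whose fuzzy closure is at least `1`; so
`c` does not increase. -/
theorem fuzzyClosure_path_le : path.fuzzyClosure ≤ 1 := by
  refine graphClosure_le fun u v _ _ => ?_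
  have : path.graph.fuzzy.commonNeighbors u v = ∅ := by
    refine Set.eq_empty_of_forall_notMem fun w hw => ?_
    exact ((SimpleGraph.mem_commonNeighbors _).mp hw).1
  rw [this]
  simp

theorem fuzzyClosure_pos_of_not_fuzzy {u v : Fin I.n} (h : ¬ I.graph.fuzzy.Adj u v) (huv : u ≠ v) :
    0 < I.fuzzyClosure :=
  Nat.zero_lt_of_lt (isClosedGraph_graphClosure I.graph.fuzzy u v huv h)

open Classical in
/-- The fuzzy closure as the number of the numbers of common neighbours that are exceeded. -/
theorem fuzzyClosure_eq_card : I.fuzzyClosure = (Finset.univ.filter fun t : Fin I.n => ∃ u v,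
    (u ≠ v ∧ ¬ I.graph.fuzzy.Adj u v) ∧ ¬ ((Finset.univ.filter fun w =>
      I.graph.fuzzy.Adj u w ∧ I.graph.fuzzy.Adj v w).card < t)).card := by
  have hcl := isClosedGraph_graphClosure I.graph.fuzzy
  have hiff : ∀ t : Fin I.n, (∃ u v, (u ≠ v ∧ ¬ I.graph.fuzzy.Adj u v) ∧
      ¬ ((Finset.univ.filter fun w =>
      I.graph.fuzzy.Adj u w ∧ I.graph.fuzzy.Adj v w).card < t)) ↔ t.val < I.fuzzyClosure := by
    intro t
    constructor
    · rintro ⟨u, v, ⟨h1, h2⟩, h3⟩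
      exact (not_lt.mp h3).trans_lt (hcl.card_lt h1 h2)
    · intro h
      have hn := Nat.notMem_of_lt_sInf h
      simp only [IsClosedGraph, Set.mem_ofPred_eq, not_forall] at hn
      obtain ⟨u, v, h1, h2, h3⟩ := hn
      refine ⟨u, v, ⟨h1, h2⟩, ?_⟩
      rwa [show I.graph.fuzzy.commonNeighbors u v = ((Finset.univ.filter fun w =>
        I.graph.fuzzy.Adj u w ∧ I.graph.fuzzy.Adj v w : Finset (Fin I.n)) : Set (Fin I.n)) by
          ext w; simp [SimpleGraph.mem_commonNeighbors], Set.ncard_coe_finset] at h3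
  -- A vertex is not its own neighbour, so there are at most `n - 1` common neighbours. Hence no
  -- number below the closure is missed by counting only those below `n`.
  have hle : I.fuzzyClosure ≤ I.n := by
    refine graphClosure_le fun u v huv _ => ?_
    have : I.graph.fuzzy.commonNeighbors u v ≠ Set.univ := fun h => by
      have hu : u ∈ I.graph.fuzzy.commonNeighbors u v := h ▸ Set.mem_univ u
      exact (SimpleGraph.mem_commonNeighbors _).mp hu |>.1.ne rfl
    have := Set.ncard_lt_card this
    simpa using this
  simp only [hiff]
  rw [Fin.card_filter_val_lt, min_eq_right hle]

end CCInstance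

/-! ### Terms that decide properties -/

/-- The term `t` decides `P` in the memory `s`. -/
def Tests (t : Tm) (s : Memory) (P : Prop) : Prop := (P → t.eval s = 1) ∧ (¬ P → t.eval s = 0)

namespace Tm

/-- Logic on the values `0` and `1` by truncated subtraction; `1 - (1 - x)` sends every positive
number to `1`. -/
protected def not (t : Tm) : Tm := .sub (.const 1) t
protected def and (t u : Tm) : Tm := .sub (.add t u) (.const 1)
protected def or (t u : Tm) : Tm := .sub (.const 1) (.sub (.const 1) (.add t u))
protected def lt (t u : Tm) : Tm := .sub (.const 1) (.sub (.const 1) (.sub u t))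
protected def eq (t u : Tm) : Tm := .sub (.const 1) (.add (.sub t u) (.sub u t))
protected def ex (r : ℕ) (t : Tm) : Tm := .sub (.const 1) (.sub (.const 1) (.sum r t))
protected def all (r : ℕ) (t : Tm) : Tm := (Tm.ex r t.not).not
protected def imp (t u : Tm) : Tm := Tm.or t.not u

end Tm

namespace Tests

variable {t u : Tm} {s : Memory} {P Q : Prop}

theorem congr (h : Tests t s P) (hPQ : P ↔ Q) : Tests t s Q := by
  rwa [← propext hPQ]

theorem not (h : Tests t s P) : Tests t.not s (¬ P) := by
  constructor <;> intro hP <;> simp only [Tm.not, Tm.eval]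
  · rw [h.2 hP]
  · rw [h.1 (not_not.mp hP)]

theorem and (h : Tests t s P) (h' : Tests u s Q) : Tests (Tm.and t u) s (P ∧ Q) := by
  constructor <;> intro hP <;> simp only [Tm.and, Tm.eval]
  · rw [h.1 hP.1, h'.1 hP.2]
  · by_cases hp : P
    · rw [h.1 hp, h'.2 fun hq => hP ⟨hp, hq⟩]
    · by_cases hq : Q
      · rw [h.2 hp, h'.1 hq]
      · rw [h.2 hp, h'.2 hq]

theorem or (h : Tests t s P) (h' : Tests u s Q) : Tests (Tm.or t u) s (P ∨ Q) := by
  constructor <;> intro hP <;> simp only [Tm.or, Tm.eval]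
  · rcases hP with hp | hq
    · rw [h.1 hp]; omega
    · rw [h'.1 hq]; omega
  · rw [h.2 fun hp => hP (Or.inl hp), h'.2 fun hq => hP (Or.inr hq)]

theorem imp (h : Tests t s P) (h' : Tests u s Q) : Tests (Tm.imp t u) s (P → Q) :=
  (h.not.or h').congr imp_iff_not_or.symm

theorem lt (t u : Tm) (s : Memory) : Tests (Tm.lt t u) s (t.eval s < u.eval s) := by
  constructor <;> intro hP <;> simp only [Tm.lt, Tm.eval] <;> omega

theorem eq (t u : Tm) (s : Memory) : Tests (Tm.eq t u) s (t.eval s = u.eval s) := by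
  constructor <;> intro hP <;> simp only [Tm.eq, Tm.eval] <;> omega

open Classical in
theorem eval_sum {n : ℕ} {r : ℕ} {P : Fin n → Prop} (h0 : s.reg 0 = n)
    (h : ∀ i : Fin n, Tests t (s.setReg r i) (P i)) :
    (Tm.sum r t).eval s = (Finset.univ.filter P).card := by
  rw [Tm.eval, h0, Finset.sum_range, Finset.card_filter]
  refine Finset.sum_congr rfl fun i _ => ?_
  split_ifs with hP
  · exact (h i).1 hP
  · exact (h i).2 hP

theorem ex {n : ℕ} {r : ℕ} {P : Fin n → Prop} (h0 : s.reg 0 = n)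
    (h : ∀ i : Fin n, Tests t (s.setReg r i) (P i)) : Tests (Tm.ex r t) s (∃ i, P i) := by
  classical
  have hs := eval_sum h0 h
  constructor <;> intro hP <;> simp only [Tm.ex, Tm.eval] at hs ⊢ <;> rw [hs]
  · obtain ⟨i, hi⟩ := hP
    have : 0 < (Finset.univ.filter P).card :=
      Finset.card_pos.mpr ⟨i, Finset.mem_filter.mpr ⟨Finset.mem_univ i, hi⟩⟩
    omega
  · rw [Finset.filter_false_of_mem fun i _ hi => hP ⟨i, hi⟩]
    rfl

theorem all {n : ℕ} {r : ℕ} {P : Fin n → Prop} (h0 : s.reg 0 = n)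
    (h : ∀ i : Fin n, Tests t (s.setReg r i) (P i)) : Tests (Tm.all r t) s (∀ i, P i) :=
  (ex h0 fun i => (h i).not).not.congr (by simp)

end Tests

/-! ### Matrices and characteristic functions in memory -/

theorem row_injective {n : ℕ} {x y x' y' : Fin n}
    (h : (x : ℕ) * n + y = x' * n + y') : x = x' ∧ y = y' := by
  have hn : 0 < n := Nat.zero_lt_of_lt x.2
  have h1 := congrArg (· / n) h
  have h2 := congrArg (· % n) h
  simp only [Nat.mul_comm _ n, Nat.mul_add_div hn, Nat.div_eq_of_lt y.2, Nat.div_eq_of_lt y'.2,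
    Nat.mul_add_mod, Nat.mod_eq_of_lt y.2, Nat.mod_eq_of_lt y'.2, add_zero] at h1 h2
  exact ⟨Fin.ext h1, Fin.ext h2⟩

namespace Tm

/-- The address of the pair of the contents of two registers in a matrix. -/
def addr (i j : ℕ) : Tm := .add (.mul (.reg i) (.reg 0)) (.reg j)

theorem eval_addr {s : Memory} {n : ℕ} {i j : ℕ} {x y : Fin n} (h0 : s.reg 0 = n)
    (hi : s.reg i = x) (hj : s.reg j = y) : (addr i j).eval s = x * n + y := by
  simp only [addr, eval, h0, hi, hj, min_eq_left x.2.le]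

/-- The entry of the array `a` for the pair of the contents of two registers. -/
def cell (a i j : ℕ) : Tm := .get a (addr i j)

theorem eval_cell {s : Memory} {n : ℕ} {a i j : ℕ} {x y : Fin n} (h0 : s.reg 0 = n)
    (hi : s.reg i = x) (hj : s.reg j = y) : (cell a i j).eval s = s.arr a (x * n + y) := by
  rw [cell, eval, eval_addr h0 hi hj]

end Tm

/-- The array `a` holds the matrix of the relation `P`. -/
def HoldsRel {n : ℕ} (a : ℕ) (P : Fin n → Fin n → Prop) (s : Memory) : Prop :=
  ∀ x y : Fin n, (P x y → s.arr a (x * n + y) = 1) ∧ (¬ P x y → s.arr a (x * n + y) = 0)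

theorem HoldsRel.tests {n : ℕ} {a : ℕ} {P : Fin n → Fin n → Prop} {s : Memory}
    (h : HoldsRel a P s) {i j : ℕ} {x y : Fin n} (h0 : s.reg 0 = n)
    (hi : s.reg i = x) (hj : s.reg j = y) : Tests (.cell a i j) s (P x y) := by
  rw [Tests, Tm.eval_cell h0 hi hj]
  exact h x y

/-- The array `a` holds the characteristic function of the predicate `P`. -/
def HoldsPred {n : ℕ} (a : ℕ) (P : Fin n → Prop) (s : Memory) : Prop :=
  ∀ x : Fin n, (P x → s.arr a x = 1) ∧ (¬ P x → s.arr a x = 0)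

theorem HoldsPred.tests {n : ℕ} {a : ℕ} {P : Fin n → Prop} {s : Memory}
    (h : HoldsPred a P s) {i : ℕ} {x : Fin n} (hi : s.reg i = x) :
    Tests (.get a (.reg i)) s (P x) := by
  rw [Tests, Tm.eval, Tm.eval, hi]
  exact h x

/-! ### Filling a matrix -/

namespace Stmt

def skip : Stmt := .assign 9 (.reg 9)

theorem run_skip (s : Memory) : skip.run s = s := by
  simp [skip, run, Memory.setReg, Tm.eval]

/-- For all values of the registers `10` and `11`, under the condition `g`, store `t` in the
array `a` under the address `e`. -/
def fill (a : ℕ) (g e t : Tm) : Stmt := .loop 10 (.loop 11 (.cond g (.store a e t) skip))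

/-- The memories differ at most in the array `a` and in the registers `10` and `11`. -/
def Frame (a : ℕ) (s s' : Memory) : Prop :=
  (∀ b ≠ a, s'.arr b = s.arr b) ∧ ∀ r, r ≠ 10 → r ≠ 11 → s'.reg r = s.reg r

/-- Injectivity of the addresses on the guarded pairs ensures that no later store destroys an entry.
Guard, address and value must be insensitive to the array being written, which is why they are
specified in every memory satisfying `Frame`. -/
theorem run_fill {a : ℕ} {g e t : Tm} {s : Memory} {n : ℕ} (h0 : s.reg 0 = n)
    (G : Fin n → Fin n → Prop) (A V : Fin n → Fin n → ℕ)
    (h : ∀ (s' : Memory) (x y : Fin n), Frame a s s' → s'.reg 10 = x → s'.reg 11 = y →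
      Tests g s' (G x y) ∧ (G x y → e.eval s' = A x y ∧ t.eval s' = V x y))
    (hinj : ∀ x y x' y', G x y → G x' y' → A x y = A x' y' → x = x' ∧ y = y') :
    Frame a s ((fill a g e t).run s) ∧
      ∀ x y, G x y → ((fill a g e t).run s).arr a (A x y) = V x y := by
  have main := run_loop (r := 10) (p := .loop 11 (.cond g (.store a e t) skip)) (s := s)
    (fun i s' => Frame a s s' ∧ ∀ x y : Fin n, x.val < i → G x y → s'.arr a (A x y) = V x y)
    ⟨⟨fun _ _ => rfl, fun _ _ _ => rfl⟩, fun x y hx => absurd hx (Nat.not_lt_zero _)⟩ ?_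
  · rw [h0] at main
    exact ⟨main.1, fun x y hG => main.2 x y x.2 hG⟩
  intro i hi s₁ ⟨hF, hV⟩
  rw [h0] at hi
  have hF0 : (s₁.setReg 10 i).reg 0 = n := by
    simp [hF.2 0 (by omega) (by omega), h0]
  have inner := run_loop (r := 11) (p := .cond g (.store a e t) skip) (s := s₁.setReg 10 i)
    (fun j s' => Frame a s s' ∧ s'.reg 10 = i ∧ ∀ x y : Fin n,
      (x.val < i ∨ (x.val = i ∧ y.val < j)) → G x y → s'.arr a (A x y) = V x y)
    ⟨⟨hF.1, fun r h1 h2 => by simp [h1, hF.2 r h1 h2]⟩, by simp, ?_⟩ ?_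
  · rw [hF0] at inner
    refine ⟨inner.1, fun x y hx hG => inner.2.2 x y ?_ hG⟩
    rcases Nat.lt_succ_iff_lt_or_eq.mp hx with hx | hx
    · exact Or.inl hx
    · exact Or.inr ⟨hx, y.2⟩
  · rintro x y (hx | ⟨-, hy⟩) hG
    · exact hV x y hx hG
    · exact absurd hy (Nat.not_lt_zero _)
  intro j hj s₂ ⟨hF₂, hi₂, hV₂⟩
  rw [hF0] at hj
  have hF₃ : Frame a s (s₂.setReg 11 j) :=
    ⟨hF₂.1, fun r h1 h2 => by simp [h2, hF₂.2 r h1 h2]⟩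
  obtain ⟨hg, hst⟩ := h (s₂.setReg 11 j) ⟨i, hi⟩ ⟨j, hj⟩ hF₃ (by simp [hi₂]) (by simp)
  by_cases hG : G ⟨i, hi⟩ ⟨j, hj⟩
  · obtain ⟨he, ht⟩ := hst hG
    rw [run, if_pos (by rw [hg.1 hG]; exact one_ne_zero), run, he, ht]
    refine ⟨⟨fun b hb => ?_, hF₃.2⟩, by simp [hi₂], fun x y hxy hGxy => ?_⟩
    · rw [Memory.setArr_arr_of_ne _ hb, hF₃.1 b hb]
    · rw [Memory.setArr_arr]
      by_cases heq : A x y = A ⟨i, hi⟩ ⟨j, hj⟩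
      · obtain ⟨rfl, rfl⟩ := hinj _ _ _ _ hGxy hG heq
        simp
      · rw [if_neg (by tauto)]
        refine hV₂ x y ?_ hGxy
        rcases hxy with hx | ⟨hx, hy⟩
        · exact Or.inl hx
        · refine Or.inr ⟨hx, lt_of_le_of_ne (Nat.le_of_lt_succ hy) fun hyj => heq ?_⟩
          rw [show x = ⟨i, hi⟩ from Fin.ext hx, show y = ⟨j, hj⟩ from Fin.ext hyj]
  · rw [run, if_neg (by rw [hg.2 hG]; exact not_not.mpr rfl), run_skip]
    refine ⟨hF₃, by simp [hi₂], fun x y hxy hGxy => hV₂ x y ?_ hGxy⟩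
    rcases hxy with hx | ⟨hx, hy⟩
    · exact Or.inl hx
    · refine Or.inr ⟨hx, lt_of_le_of_ne (Nat.le_of_lt_succ hy) fun hyj => hG ?_⟩
      rwa [← show x = ⟨i, hi⟩ from Fin.ext hx, ← show y = ⟨j, hj⟩ from Fin.ext hyj]

/-- Fill the matrix in the array `a`. -/
def fillMatrix (a : ℕ) (t : Tm) : Stmt := fill a (.const 1) (.addr 10 11) t

theorem run_fillMatrix {a : ℕ} {t : Tm} {s : Memory} {n : ℕ} (h0 : s.reg 0 = n)
    (V : Fin n → Fin n → ℕ)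
    (h : ∀ (s' : Memory) (x y : Fin n), Frame a s s' → s'.reg 10 = x → s'.reg 11 = y →
      t.eval s' = V x y) :
    Frame a s ((fillMatrix a t).run s) ∧
      ∀ x y : Fin n, ((fillMatrix a t).run s).arr a (x * n + y) = V x y := by
  have := run_fill (g := .const 1) (e := .addr 10 11) h0 (fun _ _ => True) (fun x y => x * n + y) V
    (fun s' x y hF hx hy => ⟨⟨fun _ => rfl, fun h => absurd trivial h⟩, fun _ =>
      ⟨Tm.eval_addr ((hF.2 0 (by omega) (by omega)).trans h0) hx hy, h s' x y hF hx hy⟩⟩)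
    (fun x y x' y' _ _ h => row_injective h)
  exact ⟨this.1, fun x y => this.2 x y trivial⟩

theorem run_fillMatrix_rel {a : ℕ} {t : Tm} {s : Memory} {n : ℕ} (h0 : s.reg 0 = n)
    {P : Fin n → Fin n → Prop}
    (h : ∀ (s' : Memory) (x y : Fin n), Frame a s s' → s'.reg 10 = x → s'.reg 11 = y →
      Tests t s' (P x y)) :
    Frame a s ((fillMatrix a t).run s) ∧ HoldsRel a P ((fillMatrix a t).run s) := by
  classical
  have := run_fillMatrix (a := a) h0 (fun x y => if P x y then 1 else 0) fun s' x y hF hx hy => by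
    split_ifs with hP
    · exact (h s' x y hF hx hy).1 hP
    · exact (h s' x y hF hx hy).2 hP
  refine ⟨this.1, fun x y => ⟨fun hP => ?_, fun hP => ?_⟩⟩
  · rw [this.2 x y, if_pos hP]
  · rw [this.2 x y, if_neg hP]

/-- Store the values of `f` below `m` in the array `a`. -/
def write (a : ℕ) (f : ℕ → ℕ) : ℕ → Stmt
  | 0 => skip
  | m + 1 => .seq (write a f m) (.store a (.const m) (.const (f m)))

theorem run_write (a : ℕ) (f : ℕ → ℕ) (m : ℕ) (s : Memory) :
    ((write a f m).run s).reg = s.reg ∧ (∀ b ≠ a, ((write a f m).run s).arr b = s.arr b) ∧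
      ∀ i < m, ((write a f m).run s).arr a i = f i := by
  induction m with
  | zero => simp [write, run_skip]
  | succ m ih =>
    obtain ⟨h1, h2, h3⟩ := ih
    simp only [write, run, Tm.eval]
    refine ⟨h1, fun b hb => by rw [Memory.setArr_arr_of_ne _ hb, h2 b hb], fun i hi => ?_⟩
    rw [Memory.setArr_arr]
    by_cases him : i = m
    · simp [him]
    · rw [if_neg (by tauto), h3 i (by omega)]

theorem below_write (a : ℕ) (f : ℕ → ℕ) (m : ℕ) {d : ℕ} (hd : 9 < d) : (write a f m).Below d := by
  induction m with
  | zero => exact ⟨by omega, hd, hd⟩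
  | succ m ih => exact ⟨ih, by simp only [Tm.Below]; omega, by simp only [Tm.Below]; omega⟩

end Stmt

/-! ### Deciding redundancy and membership in the core -/

theorem CCInstance.StoredIn.of_eq {I : CCInstance} {s s' : Memory} (h : I.StoredIn s)
    (h0 : s'.reg 0 = s.reg 0) (h1 : s'.reg 1 = s.reg 1)
    (ha : ∀ a < 3, s'.arr a = s.arr a) : I.StoredIn s' where
  n_eq := h0.trans h.n_eq
  k_eq := h1.trans h.k_eq
  real_iff := by rw [ha 0 (by omega)]; exact h.real_iff
  fuzzy_iff := by rw [ha 1 (by omega)]; exact h.fuzzy_iff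
  weight_eq := by rw [ha 2 (by omega)]; exact h.weight_eq

/-- The memory holds the instance and, in array `3`, the complement of the set `S`. -/
structure Holds (I : CCInstance) (S : Finset (Fin I.n)) (s : Memory) : Prop where
  stored : I.StoredIn s
  removed : HoldsPred 3 (fun x => x ∉ S) s

namespace Tm

def alive (i : ℕ) : Tm := (Tm.get 3 (.reg i)).not

def distinct (i j : ℕ) : Tm := (Tm.eq (.reg i) (.reg j)).not

def nonedge (i j : ℕ) : Tm := Tm.and (distinct i j) (Tm.and (cell 0 i j).not (cell 1 i j).not)

/-- Redundancy of the vertex in register `10`. -/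
def redundant : Tm :=
  Tm.and (alive 10) <| Tm.ex 11 <| Tm.and (alive 11) <| Tm.and (distinct 11 10) <| Tm.and
    (Tm.all 12 <| Tm.imp (Tm.and (alive 12) (cell 0 10 12)) <|
      Tm.or (Tm.eq (.reg 12) (.reg 11)) <| Tm.lt (.reg 1) <| .sum 13 <|
        Tm.and (Tm.and (alive 13) (distinct 13 10)) <| Tm.and (cell 0 12 13) (cell 0 11 13))
    (Tm.all 12 <| Tm.imp (Tm.and (alive 12) (nonedge 10 12)) <| Tm.lt (.reg 1) <| .sum 13 <|
        Tm.and (Tm.and (alive 13) (distinct 13 10)) <| Tm.and (cell 0 11 13) (nonedge 12 13))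

/-- Adjacency by a real edge within the set of the vertices that are not removed. -/
def step (i j : ℕ) : Tm := Tm.and (alive i) (Tm.and (alive j) (cell 0 i j))

/-- Membership of the vertex in register `10` in the core, given reachability in array `4`. -/
def core : Tm :=
  Tm.and (alive 10) <| Tm.ex 12 <| Tm.ex 13 <| Tm.and (cell 4 10 12) <| Tm.and (cell 4 10 13) <|
    Tm.and (Tm.and (alive 12) (alive 13)) (nonedge 12 13)

end Tm

namespace Holds

variable {I : CCInstance} {S : Finset (Fin I.n)} {s : Memory}

theorem setReg (h : Holds I S s) {r : ℕ} (hr : 2 ≤ r) (x : ℕ) : Holds I S (s.setReg r x) where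
  stored := h.stored.of_eq (by simp; omega) (by simp; omega) fun _ _ => rfl
  removed := h.removed

theorem of_frame (h : Holds I S s) {a : ℕ} (ha : 4 ≤ a) {s' : Memory} (hF : Stmt.Frame a s s') :
    Holds I S s' where
  stored := h.stored.of_eq (hF.2 0 (by omega) (by omega)) (hF.2 1 (by omega) (by omega))
    fun b hb => hF.1 b (by omega)
  removed := by
    have := h.removed
    rwa [HoldsPred, ← hF.1 3 (by omega)] at this

theorem alive (h : Holds I S s) {i : ℕ} {x : Fin I.n} (hi : s.reg i = x) :
    Tests (.alive i) s (x ∈ S) := (h.removed.tests hi).not.congr not_not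

theorem real (h : Holds I S s) {i j : ℕ} {x y : Fin I.n} (hi : s.reg i = x) (hj : s.reg j = y) :
    Tests (.cell 0 i j) s (I.graph.real.Adj x y) :=
  HoldsRel.tests (P := I.graph.real.Adj) h.stored.real_iff h.stored.n_eq hi hj

theorem fuzzy (h : Holds I S s) {i j : ℕ} {x y : Fin I.n} (hi : s.reg i = x) (hj : s.reg j = y) :
    Tests (.cell 1 i j) s (I.graph.fuzzy.Adj x y) :=
  HoldsRel.tests (P := I.graph.fuzzy.Adj) h.stored.fuzzy_iff h.stored.n_eq hi hj

end Holds

theorem tests_eq {n : ℕ} {s : Memory} {i j : ℕ} {x y : Fin n} (hi : s.reg i = x)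
    (hj : s.reg j = y) : Tests (Tm.eq (.reg i) (.reg j)) s (x = y) :=
  (Tests.eq _ _ _).congr (by simp only [Tm.eval, hi, hj, Fin.ext_iff])

theorem tests_distinct {n : ℕ} {s : Memory} {i j : ℕ} {x y : Fin n} (hi : s.reg i = x)
    (hj : s.reg j = y) : Tests (.distinct i j) s (x ≠ y) := (tests_eq hi hj).not

namespace Holds

variable {I : CCInstance} {S : Finset (Fin I.n)} {s : Memory}

theorem nonedge (h : Holds I S s) {i j : ℕ} {x y : Fin I.n} (hi : s.reg i = x)
    (hj : s.reg j = y) : Tests (.nonedge i j) s (I.graph.nonedge.Adj x y) :=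
  ((tests_distinct hi hj).and ((h.real hi hj).not.and (h.fuzzy hi hj).not)).congr
    CCInstance.nonedge_adj.symm

theorem redundant (h : Holds I S s) {v : Fin I.n} (hv : s.reg 10 = v) :
    Tests .redundant s (I.Redundant S v) := by
  classical
  refine (h.alive hv).and (Tests.ex h.stored.n_eq fun u => ?_)
  have h₁ := h.setReg (r := 11) (by omega) u
  refine (h₁.alive (by simp)).and ((tests_distinct (by simp) (by simp [hv])).and (.and ?_ ?_))
  · refine Tests.all h₁.stored.n_eq fun x => ?_
    have h₂ := h₁.setReg (r := 12) (by omega) x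
    refine Tests.imp ((h₂.alive (by simp)).and (h₂.real (by simp [hv]) (by simp))) ?_
    refine Tests.or (tests_eq (by simp) (by simp)) ((Tests.lt _ _ _).congr ?_)
    rw [Tests.eval_sum h₂.stored.n_eq (P := fun w => (w ∈ S ∧ w ≠ v) ∧
      I.graph.real.Adj x w ∧ I.graph.real.Adj u w), Tm.eval, h₂.stored.k_eq]
    · congr!
    intro w
    have h₃ := h₂.setReg (r := 13) (by omega) w
    exact ((h₃.alive (by simp)).and (tests_distinct (by simp) (by simp [hv]))).and
      ((h₃.real (by simp) (by simp)).and (h₃.real (by simp) (by simp)))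
  · refine Tests.all h₁.stored.n_eq fun z => ?_
    have h₂ := h₁.setReg (r := 12) (by omega) z
    refine Tests.imp ((h₂.alive (by simp)).and (h₂.nonedge (by simp [hv]) (by simp))) ?_
    refine (Tests.lt _ _ _).congr ?_
    rw [Tests.eval_sum h₂.stored.n_eq (P := fun w => (w ∈ S ∧ w ≠ v) ∧
      I.graph.real.Adj u w ∧ I.graph.nonedge.Adj z w), Tm.eval, h₂.stored.k_eq]
    · congr!
    intro w
    have h₃ := h₂.setReg (r := 13) (by omega) w
    exact ((h₃.alive (by simp)).and (tests_distinct (by simp) (by simp [hv]))).and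
      ((h₃.real (by simp) (by simp)).and (h₃.nonedge (by simp) (by simp)))

theorem step (h : Holds I S s) {i j : ℕ} {x y : Fin I.n} (hi : s.reg i = x) (hj : s.reg j = y) :
    Tests (.step i j) s ((I.realOn S).Adj x y) :=
  (h.alive hi).and ((h.alive hj).and (h.real hi hj))

theorem core (h : Holds I S s) (h4 : HoldsRel 4 (I.realOn S).Reachable s) {v : Fin I.n}
    (hv : s.reg 10 = v) : Tests .core s (v ∈ I.core S) := by
  refine ((h.alive hv).and (Tests.ex h.stored.n_eq fun x => ?_)).congr CCInstance.mem_core.symm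
  have h₁ := h.setReg (r := 12) (by omega) x
  refine Tests.ex h₁.stored.n_eq fun y => ?_
  have h₂ := h₁.setReg (r := 13) (by omega) y
  have h4' : HoldsRel 4 (I.realOn S).Reachable ((s.setReg 12 x).setReg 13 y) := h4
  exact (h4'.tests h₂.stored.n_eq (by simp [hv]) (by simp)).and
    ((h4'.tests h₂.stored.n_eq (by simp [hv]) (by simp)).and
    (((h₂.alive (by simp)).and (h₂.alive (by simp))).and (h₂.nonedge (by simp) (by simp))))

end Holds

/-! ### Removing the redundant vertices -/

namespace Stmt

/-- Remove the vertex in register `10` if it is redundant. -/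
def removeOne : Stmt := .cond .redundant (.store 3 (.reg 10) (.const 1)) skip

/-- Remove redundant vertices until none is left. -/
def removeAll : Stmt := .loop 2 (.loop 10 removeOne)

end Stmt

section

variable {I : CCInstance} {S : Finset (Fin I.n)} {s : Memory}

theorem run_removeOne (h : Holds I S s) {v : Fin I.n} (hv : s.reg 10 = v) :
    (I.Redundant S v → Holds I (S.erase v) (Stmt.removeOne.run s)) ∧
    (¬ I.Redundant S v → Stmt.removeOne.run s = s) := by
  refine ⟨fun hR => ?_, fun hR => ?_⟩ <;> rw [Stmt.removeOne, Stmt.run]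
  · rw [if_pos (by rw [(h.redundant hv).1 hR]; exact one_ne_zero), Stmt.run]
    refine ⟨h.stored.of_eq rfl rfl fun a ha => Memory.setArr_arr_of_ne _ (by omega) _ _,
      fun x => ?_⟩
    rw [Memory.setArr_arr, Tm.eval, Tm.eval, hv]
    by_cases hx : x = v
    · simp [hx]
    · rw [if_neg fun hh => hx (Fin.ext hh.2)]
      simpa [hx] using h.removed x
  · rw [if_neg (by rw [(h.redundant hv).2 hR]; exact not_not.mpr rfl), Stmt.run_skip]

/-- A deletion may affect the redundancy of vertices that were already inspected, so the scan is
repeated `n` times. Every scan either deletes a vertex or shows that no redundant one is left, and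
after `n` deleting scans nothing remains. -/
theorem run_removeAll (h : Holds I S s) : ∃ S', Holds I S' (Stmt.removeAll.run s) ∧
    (I.YesOn S' ↔ I.YesOn S) ∧ ∀ v, ¬ I.Redundant S' v := by
  have main := Stmt.run_loop (r := 2) (p := .loop 10 Stmt.removeOne) (s := s)
    (fun i s' => ∃ S', Holds I S' s' ∧ (I.YesOn S' ↔ I.YesOn S) ∧
      ((∀ v, ¬ I.Redundant S' v) ∨ S'.card + i ≤ I.n)) ⟨S, h, Iff.rfl, Or.inr ?_⟩ ?_
  · rw [h.stored.n_eq] at main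
    obtain ⟨S', h1, h2, h3 | h3⟩ := main
    · exact ⟨S', h1, h2, h3⟩
    · have h4 : S' = ∅ := Finset.card_eq_zero.mp (by omega)
      exact ⟨S', h1, h2, fun v hv => absurd hv.1 (h4 ▸ Finset.notMem_empty v)⟩
  · simpa using Finset.card_le_univ S
  rintro i - s₁ ⟨S₁, h₁, hyes, hcard⟩
  have h₂ := h₁.setReg (r := 2) le_rfl i
  have inner := Stmt.run_loop (r := 10) (p := Stmt.removeOne) (s := s₁.setReg 2 i)
    (fun j s' => ∃ S', Holds I S' s' ∧ (I.YesOn S' ↔ I.YesOn S) ∧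
      -- Within a scan, either nothing has been deleted and the vertices before `j` are not
      -- redundant, or the set has shrunk. The second case records that the scan started with a
      -- redundant vertex, which excludes the first alternative of the outer invariant.
      ((S' = S₁ ∧ ∀ v : Fin I.n, v.val < j → ¬ I.Redundant S₁ v) ∨
      (S'.card < S₁.card ∧ ∃ v, I.Redundant S₁ v))) ⟨S₁, h₂, hyes, Or.inl ⟨rfl, ?_⟩⟩ ?_
  · rw [h₂.stored.n_eq] at inner
    obtain ⟨S', h3, h4, ⟨rfl, h5⟩ | ⟨h5, v, hv⟩⟩ := inner
    · exact ⟨S', h3, h4, Or.inl fun v => h5 v v.2⟩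
    · refine ⟨S', h3, h4, Or.inr ?_⟩
      rcases hcard with hcard | hcard
      · exact absurd hv (hcard v)
      · omega
  · exact fun v hv => absurd hv (Nat.not_lt_zero _)
  rintro j hj s₃ ⟨S₃, h₃, hyes₃, hdis⟩
  rw [h₂.stored.n_eq] at hj
  have h₄ := h₃.setReg (r := 10) (by omega) j
  obtain ⟨hpos, hneg⟩ := run_removeOne h₄ (v := ⟨j, hj⟩) (by simp)
  by_cases hR : I.Redundant S₃ ⟨j, hj⟩
  · refine ⟨S₃.erase ⟨j, hj⟩, hpos hR, hR.yesOn_erase_iff.trans hyes₃, Or.inr ?_⟩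
    have hlt := Finset.card_erase_lt_of_mem hR.1
    rcases hdis with ⟨rfl, -⟩ | ⟨h5, hv⟩
    · exact ⟨hlt, _, hR⟩
    · exact ⟨by omega, hv⟩
  · rw [hneg hR]
    refine ⟨S₃, h₄, hyes₃, ?_⟩
    rcases hdis with ⟨rfl, h5⟩ | h5
    · refine Or.inl ⟨rfl, fun v hv => ?_⟩
      rcases Nat.lt_succ_iff_lt_or_eq.mp hv with hv | hv
      · exact h5 v hv
      · rwa [show v = ⟨j, hj⟩ from Fin.ext hv]
    · exact Or.inr h5

end

/-! ### Reachability and the core -/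

/-- There is a walk of length at most `j`. -/
def ReachIn {V : Type*} (H : SimpleGraph V) (j : ℕ) (x y : V) : Prop :=
  ∃ p : H.Walk x y, p.length ≤ j

theorem reachIn_zero {V : Type*} (H : SimpleGraph V) {x y : V} : ReachIn H 0 x y ↔ x = y := by
  constructor
  · rintro ⟨p, hp⟩
    exact SimpleGraph.Walk.eq_of_length_eq_zero (Nat.le_zero.mp hp)
  · rintro rfl
    exact ⟨.nil, le_rfl⟩

theorem reachIn_succ {V : Type*} (H : SimpleGraph V) {j : ℕ} {x y : V} :
    ReachIn H (j + 1) x y ↔ ∃ z, (x = z ∨ H.Adj x z) ∧ ReachIn H j z y := by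
  constructor
  · rintro ⟨p, hp⟩
    cases p with
    | nil => exact ⟨x, Or.inl rfl, .nil, Nat.zero_le _⟩
    | cons hadj p => exact ⟨_, Or.inr hadj, p, Nat.le_of_succ_le_succ hp⟩
  · rintro ⟨z, rfl | hadj, p, hp⟩
    · exact ⟨p, hp.trans (Nat.le_succ j)⟩
    · exact ⟨.cons hadj p, Nat.succ_le_succ hp⟩

theorem reachIn_card {V : Type*} [Fintype V] (H : SimpleGraph V) {x y : V} :
    ReachIn H (Fintype.card V) x y ↔ H.Reachable x y := by
  constructor
  · rintro ⟨p, -⟩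
    exact ⟨p⟩
  · intro h
    obtain ⟨p, hp⟩ := h.exists_isPath
    exact ⟨p, hp.length_lt.le⟩

namespace Stmt

/-- Compute reachability by real edges into array `4`, with array `5` as a buffer. -/
def reach : Stmt := .seq (fillMatrix 4 (Tm.eq (.reg 10) (.reg 11))) <| .loop 2 <| .seq
  (fillMatrix 5 <| Tm.ex 14 <| Tm.and (Tm.or (Tm.eq (.reg 10) (.reg 14)) (.step 10 14))
    (.cell 4 14 11))
  (fillMatrix 4 (.cell 5 10 11))

/-- Compute the core into array `6`. -/
def core : Stmt := .seq reach (fill 6 (Tm.eq (.reg 10) (.reg 11)) (.reg 10) .core)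

end Stmt

section

variable {I : CCInstance} {S : Finset (Fin I.n)} {s : Memory}

theorem HoldsRel.of_arr_eq {n a : ℕ} {P : Fin n → Fin n → Prop} {s s' : Memory}
    (h : HoldsRel a P s) (ha : s'.arr a = s.arr a) : HoldsRel a P s' := by
  rwa [HoldsRel, ha]

/-- Round `j` turns walks of length at most `j` into walks of length at most `j + 1`. The buffer is
needed because all entries of the next matrix depend on the old one; `n` rounds suffice as a path
has fewer than `n` edges. -/
theorem run_reach (h : Holds I S s) : Holds I S (Stmt.reach.run s) ∧
    HoldsRel 4 (I.realOn S).Reachable (Stmt.reach.run s) := by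
  rw [Stmt.reach, Stmt.run]
  obtain ⟨hF, h4⟩ := Stmt.run_fillMatrix_rel (a := 4) (t := Tm.eq (.reg 10) (.reg 11))
    h.stored.n_eq (P := fun x y => x = y) fun s' x y _ hx hy => tests_eq hx hy
  have h₁ := h.of_frame (by omega) hF
  generalize (Stmt.fillMatrix 4 (Tm.eq (.reg 10) (.reg 11))).run s = s₁ at h₁ h4
  have main := Stmt.run_loop (r := 2) (p := .seq
    (Stmt.fillMatrix 5 <| Tm.ex 14 <| Tm.and (Tm.or (Tm.eq (.reg 10) (.reg 14)) (.step 10 14))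
    (.cell 4 14 11)) (Stmt.fillMatrix 4 (.cell 5 10 11))) (s := s₁)
    (fun j s' => Holds I S s' ∧ HoldsRel 4 (ReachIn (I.realOn S) j) s') ⟨h₁, fun x y => ?_⟩ ?_
  · rw [h₁.stored.n_eq] at main
    refine ⟨main.1, fun x y => ?_⟩
    have := main.2 x y
    rwa [← reachIn_card, Fintype.card_fin]
  · rw [reachIn_zero]
    exact h4 x y
  rintro j - s₂ ⟨h₂, hj⟩
  have h₃ := h₂.setReg (r := 2) le_rfl j
  rw [Stmt.run]
  obtain ⟨hF, h5⟩ := Stmt.run_fillMatrix_rel (a := 5)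
    (t := Tm.ex 14 <| Tm.and (Tm.or (Tm.eq (.reg 10) (.reg 14)) (.step 10 14)) (.cell 4 14 11))
    h₃.stored.n_eq (P := ReachIn (I.realOn S) (j + 1)) fun s' x y hF hx hy => by
      have h' := h₃.of_frame (by omega) hF
      refine (Tests.ex h'.stored.n_eq fun z => ?_).congr (reachIn_succ _).symm
      have h'' := h'.setReg (r := 14) (by omega) z
      have h4' : HoldsRel 4 (ReachIn (I.realOn S) j) (s'.setReg 14 z) :=
        hj.of_arr_eq (hF.1 4 (by omega))
      exact ((tests_eq (by simp [hx]) (by simp)).or (h''.step (by simp [hx]) (by simp))).and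
        (h4'.tests h''.stored.n_eq (by simp) (by simp [hy]))
  have h₄ := h₃.of_frame (by omega) hF
  obtain ⟨hF', h6⟩ := Stmt.run_fillMatrix_rel (a := 4) (t := .cell 5 10 11)
    h₄.stored.n_eq (P := ReachIn (I.realOn S) (j + 1)) fun s' x y hF hx hy =>
      (h5.of_arr_eq (hF.1 5 (by omega))).tests (h₄.of_frame (by omega) hF).stored.n_eq hx hy
  exact ⟨h₄.of_frame (by omega) hF', h6⟩

theorem run_core (h : Holds I S s) : Holds I S (Stmt.core.run s) ∧
    HoldsPred 6 (fun v => v ∈ I.core S) (Stmt.core.run s) := by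
  classical
  obtain ⟨h₁, h4⟩ := run_reach h
  rw [Stmt.core, Stmt.run]
  -- Restricting the matrix loop to the diagonal fills a vector.
  obtain ⟨hF, h6⟩ := Stmt.run_fill (a := 6) (g := Tm.eq (.reg 10) (.reg 11)) (e := .reg 10)
    (t := .core) h₁.stored.n_eq (fun x y => x = y) (fun x _ => x)
    (fun x _ => if x ∈ I.core S then 1 else 0)
    (fun s' x y hF hx hy => by
      refine ⟨tests_eq hx hy, fun _ => ⟨hx, ?_⟩⟩
      have := (h₁.of_frame (by omega) hF).core (h4.of_arr_eq (hF.1 4 (by omega))) hx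
      split_ifs with hc
      · exact this.1 hc
      · exact this.2 hc)
    (by
      rintro x _ x' _ rfl rfl hxx
      exact ⟨Fin.ext hxx, Fin.ext hxx⟩)
  refine ⟨h₁.of_frame (by omega) hF, fun x => ⟨fun hx => ?_, fun hx => ?_⟩⟩
  · rw [h6 x x rfl, if_pos hx]
  · rw [h6 x x rfl, if_neg hx]

end

/-! ### Writing the output -/

/-- The memory holds the instance, the set `A` in array `6` and its cardinality in register `3`. -/
structure Ready (I : CCInstance) (A : Finset (Fin I.n)) (s : Memory) : Prop where
  stored : I.StoredIn s
  selected : HoldsPred 6 (fun x => x ∈ A) s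
  card_eq : s.reg 3 = A.card

/-- The instance is stored in the memory once the registers `3` and `6` are moved to `0` and
`1`. -/
def Output (J : CCInstance) (s : Memory) : Prop :=
  ∀ s' : Memory, s'.arr = s.arr → s'.reg 0 = s.reg 3 → s'.reg 1 = s.reg 6 → J.StoredIn s'

namespace Tm

/-- The number of the selected vertices below the content of a register. -/
def rank (i : ℕ) : Tm := .sum 15 (Tm.and (.get 6 (.reg 15)) (Tm.lt (.reg 15) (.reg i)))

/-- The number of selected vertices beyond `30 * k ^ 2 * c ^ 2`. -/
def excess : Tm := .sub (.reg 3)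
  (.mul (.reg 5) (.mul (.reg 5) (.mul (.reg 4) (.mul (.reg 4) (.const 30)))))

/-- The fuzzy closure. -/
def closure : Tm := .sum 12 <| Tm.ex 13 <| Tm.ex 14 <|
  Tm.and (Tm.and (distinct 13 14) (cell 1 13 14).not) <|
    (Tm.lt (.sum 15 (Tm.and (cell 1 13 15) (cell 1 14 15))) (.reg 12)).not

end Tm

namespace Stmt

/-- Store the values of a term for the pairs of selected vertices. -/
def extract (a : ℕ) (t : Tm) : Stmt := fill a (Tm.and (.get 6 (.reg 10)) (.get 6 (.reg 11)))
  (.add (.mul (.rank 10) (.reg 3)) (.rank 11)) t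

/-- Copy a matrix to the array `a`. -/
def copy (a b : ℕ) : Stmt := fillMatrix a (.cell b 10 11)

/-- Output the instance induced by the selected vertices. -/
def outputInduced : Stmt :=
  .seq (extract 7 (.cell 0 10 11)) <| .seq (extract 8 (.cell 1 10 11)) <|
  .seq (extract 9 (.sub (.cell 2 10 11) (.sub (.cell 2 10 11) (.add (.reg 1) (.const 1))))) <|
  .seq (copy 0 7) <| .seq (copy 1 8) <| .seq (copy 2 9) (.assign 6 (.reg 1))

/-- Output a fixed no-instance. -/
def outputPath : Stmt :=
  .seq (write 0 (fun i => i % 2) 9) <| .seq (write 1 (fun _ => 0) 9) <|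
  .seq (write 2 (fun i => if i % 4 = 0 then 0 else 1) 9) <|
  .seq (.assign 3 (.const 3)) (.assign 6 (.const 0))

def kernelize : Stmt :=
  .seq removeAll <| .seq core <| .seq (.assign 3 (.sum 12 (.get 6 (.reg 12)))) <|
  .seq (.assign 4 .closure) <| .seq (.assign 5 (.sub (.reg 0) (.sub (.reg 0) (.reg 1)))) <|
  .cond .excess outputPath outputInduced

end Stmt

section

variable {I : CCInstance} {A : Finset (Fin I.n)} {s : Memory}

theorem Ready.of_frame (h : Ready I A s) {a : ℕ} (ha : 7 ≤ a) {s' : Memory}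
    (hF : Stmt.Frame a s s') : Ready I A s' where
  stored := h.stored.of_eq (hF.2 0 (by omega) (by omega)) (hF.2 1 (by omega) (by omega))
    fun b hb => hF.1 b (by omega)
  selected := by
    have := h.selected
    rwa [HoldsPred, ← hF.1 6 (by omega)] at this
  card_eq := (hF.2 3 (by omega) (by omega)).trans h.card_eq

theorem Ready.eval_rank (h : Ready I A s) {i : ℕ} (hi15 : i ≠ 15) {x : Fin (I.induce A).n}
    (hi : s.reg i = I.emb A x) : (Tm.rank i).eval s = x := by
  classical
  rw [Tm.rank, Tests.eval_sum h.stored.n_eq (P := fun w => w ∈ A ∧ w < I.emb A x)]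
  · rw [← CCInstance.card_filter_lt_emb x]
    congr 1
    ext w
    simp
  intro w
  have hsel : HoldsPred 6 (fun x => x ∈ A) (s.setReg 15 w) := h.selected
  refine (hsel.tests (by simp)).and ((Tests.lt _ _ _).congr ?_)
  simp [Tm.eval, hi15, hi]

theorem run_extract (h : Ready I A s) {a : ℕ} (ha : 7 ≤ a) {t : Tm} (V : Fin I.n → Fin I.n → ℕ)
    (ht : ∀ (s' : Memory) (x y : Fin I.n), Ready I A s' → s'.reg 10 = x → s'.reg 11 = y →
      t.eval s' = V x y) :
    Stmt.Frame a s ((Stmt.extract a t).run s) ∧ ∀ i j : Fin (I.induce A).n,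
      ((Stmt.extract a t).run s).arr a (i * (I.induce A).n + j) = V (I.emb A i) (I.emb A j) := by
  classical
  -- The rank is injective only on `A`; the guard of `extract` restricts the stores to that set.
  let ρ : Fin I.n → ℕ := fun x => (A.filter fun v => v < x).card
  have hρ : ∀ i, ρ (I.emb A i) = i := CCInstance.card_filter_lt_emb
  have main := Stmt.run_fill (a := a) (t := t)
    (g := Tm.and (.get 6 (.reg 10)) (.get 6 (.reg 11)))
    (e := .add (.mul (.rank 10) (.reg 3)) (.rank 11)) h.stored.n_eq (fun x y => x ∈ A ∧ y ∈ A)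
    (fun x y => ρ x * (I.induce A).n + ρ y) V ?_ ?_
  · refine ⟨main.1, fun i j => ?_⟩
    have := main.2 (I.emb A i) (I.emb A j) ⟨CCInstance.emb_mem i, CCInstance.emb_mem j⟩
    rwa [hρ, hρ] at this
  · intro s' x y hF hx hy
    have h' := h.of_frame ha hF
    refine ⟨(h'.selected.tests hx).and (h'.selected.tests hy), ?_⟩
    rintro ⟨hxA, hyA⟩
    refine ⟨?_, ht s' x y h' hx hy⟩
    obtain ⟨i, rfl⟩ := CCInstance.exists_emb_eq hxA
    obtain ⟨j, rfl⟩ := CCInstance.exists_emb_eq hyA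
    have hle : (i : ℕ) ≤ I.n := i.2.le.trans
      ((Finset.card_le_univ A).trans (Fintype.card_fin _).le)
    rw [Tm.eval, Tm.eval, h'.eval_rank (by omega) hx, h'.eval_rank (by omega) hy, hρ, hρ,
      h'.stored.n_eq, min_eq_left hle, Tm.eval, h'.card_eq]
    rfl
  · rintro x y x' y' ⟨hx, hy⟩ ⟨hx', hy'⟩ heq
    obtain ⟨i, rfl⟩ := CCInstance.exists_emb_eq hx
    obtain ⟨j, rfl⟩ := CCInstance.exists_emb_eq hy
    obtain ⟨i', rfl⟩ := CCInstance.exists_emb_eq hx'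
    obtain ⟨j', rfl⟩ := CCInstance.exists_emb_eq hy'
    simp only [hρ] at heq
    obtain ⟨rfl, rfl⟩ := row_injective heq
    exact ⟨rfl, rfl⟩

theorem run_copy {n a b : ℕ} (hab : b ≠ a) (h0 : s.reg 0 = n) :
    Stmt.Frame a s ((Stmt.copy a b).run s) ∧
      ∀ m < n * n, ((Stmt.copy a b).run s).arr a m = s.arr b m := by
  obtain ⟨hF, hV⟩ := Stmt.run_fillMatrix (a := a) (t := .cell b 10 11) h0
    (fun x y => s.arr b (x * n + y)) fun s' x y hF hx hy => by
      rw [Tm.eval_cell ((hF.2 0 (by omega) (by omega)).trans h0) hx hy, hF.1 b hab]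
  refine ⟨hF, fun m hm => ?_⟩
  have hn : 0 < n := Nat.pos_of_mul_pos_right (Nat.zero_lt_of_lt hm)
  have := hV ⟨m / n, Nat.div_lt_of_lt_mul hm⟩ ⟨m % n, Nat.mod_lt m hn⟩
  simp only [Nat.div_add_mod'] at this
  exact this

/-- All three matrices are collected in scratch arrays while the input is still intact, and copied
to their final places afterwards. Copying `n²` cells covers the smaller matrices. -/
theorem run_outputInduced (h : Ready I A s) :
    Output (I.induce A) (Stmt.outputInduced.run s) := by
  classical
  have hbase : ∀ {s' : Memory} {a : ℕ} {x y : Fin I.n}, Ready I A s' → s'.reg 10 = x →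
      s'.reg 11 = y → (Tm.cell a 10 11).eval s' = s'.arr a (x * I.n + y) :=
    fun h' hx hy => Tm.eval_cell h'.stored.n_eq hx hy
  simp only [Stmt.outputInduced, Stmt.run]
  obtain ⟨hF₁, h7⟩ := run_extract h (a := 7) (by omega) (t := .cell 0 10 11)
    (fun x y => if I.graph.real.Adj x y then 1 else 0) fun s' x y h' hx hy => by
      rw [hbase h' hx hy]
      split_ifs with hR
      · exact (h'.stored.real_iff x y).1 hR
      · exact (h'.stored.real_iff x y).2 hR
  have h₁ := h.of_frame (by omega) hF₁
  generalize (Stmt.extract 7 _).run s = s₁ at hF₁ h7 h₁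
  obtain ⟨hF₂, h8⟩ := run_extract h₁ (a := 8) (by omega) (t := .cell 1 10 11)
    (fun x y => if I.graph.fuzzy.Adj x y then 1 else 0) fun s' x y h' hx hy => by
      rw [hbase h' hx hy]
      split_ifs with hR
      · exact (h'.stored.fuzzy_iff x y).1 hR
      · exact (h'.stored.fuzzy_iff x y).2 hR
  have h₂ := h₁.of_frame (by omega) hF₂
  rw [← hF₂.1 7 (by omega)] at h7
  generalize (Stmt.extract 8 _).run s₁ = s₂ at hF₂ h7 h8 h₂
  obtain ⟨hF₃, h9⟩ := run_extract h₂ (a := 9) (by omega)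
    (t := .sub (.cell 2 10 11) (.sub (.cell 2 10 11) (.add (.reg 1) (.const 1))))
    (fun x y => min (I.weight s(x, y)) (I.k + 1)) fun s' x y h' hx hy => by
      simp only [Tm.eval]
      rw [hbase h' hx hy, h'.stored.weight_eq, h'.stored.k_eq]
      omega
  have h₃ := h₂.of_frame (by omega) hF₃
  rw [← hF₃.1 7 (by omega)] at h7
  rw [← hF₃.1 8 (by omega)] at h8
  generalize (Stmt.extract 9 _).run s₂ = s₃ at hF₃ h7 h8 h9 h₃
  obtain ⟨hG₁, c0⟩ := run_copy (a := 0) (b := 7) (by omega) h₃.stored.n_eq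
  rw [← hG₁.1 8 (by omega)] at h8
  rw [← hG₁.1 9 (by omega)] at h9
  generalize (Stmt.copy 0 7).run s₃ = s₄ at hG₁ h8 h9 c0
  have n₄ : s₄.reg 0 = I.n := (hG₁.2 0 (by omega) (by omega)).trans h₃.stored.n_eq
  obtain ⟨hG₂, c1⟩ := run_copy (a := 1) (b := 8) (by omega) n₄
  rw [← hG₂.1 9 (by omega)] at h9
  rw [← hG₂.1 0 (by omega)] at c0
  generalize (Stmt.copy 1 8).run s₄ = s₅ at hG₂ h9 c0 c1
  have n₅ : s₅.reg 0 = I.n := (hG₂.2 0 (by omega) (by omega)).trans n₄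
  obtain ⟨hG₃, c2⟩ := run_copy (a := 2) (b := 9) (by omega) n₅
  rw [← hG₃.1 0 (by omega)] at c0
  rw [← hG₃.1 1 (by omega)] at c1
  generalize (Stmt.copy 2 9).run s₅ = s₆ at hG₃ c0 c1 c2
  have r3 : s₆.reg 3 = A.card := by
    rw [hG₃.2 3 (by omega) (by omega), hG₂.2 3 (by omega) (by omega),
      hG₁.2 3 (by omega) (by omega), h₃.card_eq]
  have r1 : s₆.reg 1 = I.k := by
    rw [hG₃.2 1 (by omega) (by omega), hG₂.2 1 (by omega) (by omega),
      hG₁.2 1 (by omega) (by omega), h₃.stored.k_eq]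
  have haddr : ∀ i j : Fin (I.induce A).n, (i : ℕ) * (I.induce A).n + j < I.n * I.n := by
    intro i j
    have hle : (I.induce A).n ≤ I.n := by
      have := Finset.card_le_univ A
      rwa [Fintype.card_fin] at this
    calc (i : ℕ) * (I.induce A).n + j < i * (I.induce A).n + (I.induce A).n := by
          have := j.2; omega
      _ = (i + 1) * (I.induce A).n := by ring
      _ ≤ I.n * I.n := Nat.mul_le_mul (i.2.trans_le hle) hle
  intro s' ha h0 h1
  refine ⟨?_, ?_, fun i j => ?_, fun i j => ?_, fun i j => ?_⟩
  · rw [h0]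
    simp only [Memory.setReg_reg]
    exact r3
  · rw [h1]
    simp only [Memory.setReg_reg, Tm.eval, if_true]
    exact r1
  · rw [ha, Memory.setReg_arr, c0 _ (haddr i j), h7]
    exact ⟨fun hR => if_pos hR, fun hR => if_neg hR⟩
  · rw [ha, Memory.setReg_arr, c1 _ (haddr i j), h8]
    exact ⟨fun hR => if_pos hR, fun hR => if_neg hR⟩
  · rw [ha, Memory.setReg_arr, c2 _ (haddr i j), h9]
    rfl

/-- In a `3 × 3` matrix stored row by row, the odd addresses are the pairs of consecutive vertices
and the multiples of `4` are the diagonal. -/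
theorem run_outputPath (s : Memory) : Output CCInstance.path (Stmt.outputPath.run s) := by
  simp only [Stmt.outputPath, Stmt.run]
  obtain ⟨-, -, h0⟩ := Stmt.run_write 0 (fun i => i % 2) 9 s
  generalize (Stmt.write 0 _ 9).run s = s₁ at h0
  obtain ⟨-, f1, h1⟩ := Stmt.run_write 1 (fun _ => 0) 9 s₁
  rw [← f1 0 (by omega)] at h0
  generalize (Stmt.write 1 _ 9).run s₁ = s₂ at h0 h1
  obtain ⟨-, f2, h2⟩ := Stmt.run_write 2 (fun i => if i % 4 = 0 then 0 else 1) 9 s₂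
  rw [← f2 0 (by omega)] at h0
  rw [← f2 1 (by omega)] at h1
  generalize (Stmt.write 2 _ 9).run s₂ = s₃ at h0 h1 h2
  intro s' ha hn hk
  have hlt : ∀ i j : Fin 3, (i : ℕ) * 3 + j < 9 := by omega
  refine ⟨?_, ?_, fun i j => ?_, fun i j => ?_, fun i j => ?_⟩
  · simp only [Memory.setReg_reg, Tm.eval] at hn
    exact hn
  · simp only [Memory.setReg_reg, Tm.eval, if_true] at hk
    exact hk
  · rw [ha]
    simp only [Memory.setReg_arr]
    have e := h0 _ (hlt i j)
    change (((i : Fin 3).val + 1 = (j : Fin 3).val ∨ (j : Fin 3).val + 1 = (i : Fin 3).val) →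
      s₃.arr 0 (i * 3 + j) = 1) ∧ (¬ ((i : Fin 3).val + 1 = (j : Fin 3).val ∨
      (j : Fin 3).val + 1 = (i : Fin 3).val) → s₃.arr 0 (i * 3 + j) = 0)
    rw [e]
    have hi : i.val < 3 := i.2
    have hj : j.val < 3 := j.2
    constructor <;> intro h <;> omega
  · rw [ha]
    simp only [Memory.setReg_arr]
    exact ⟨fun h => absurd h id, fun _ => h1 _ (hlt i j)⟩
  · rw [ha]
    simp only [Memory.setReg_arr]
    refine (h2 _ (hlt i j)).trans ?_
    change _ = if s(i, j).IsDiag then 0 else 1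
    have hi : i.val < 3 := i.2
    have hj : j.val < 3 := j.2
    have hiff : (i.val * 3 + j.val) % 4 = 0 ↔ s(i, j).IsDiag := by
      rw [Sym2.mk_isDiag_iff, Fin.ext_iff]
      omega
    simp only [hiff]

theorem Holds.eval_closure {S : Finset (Fin I.n)} (h : Holds I S s) :
    Tm.closure.eval s = I.fuzzyClosure := by
  classical
  rw [CCInstance.fuzzyClosure_eq_card, Tm.closure, Tests.eval_sum h.stored.n_eq
    (P := fun t : Fin I.n => ∃ u v, (u ≠ v ∧ ¬ I.graph.fuzzy.Adj u v) ∧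
      ¬ ((Finset.univ.filter fun w => I.graph.fuzzy.Adj u w ∧ I.graph.fuzzy.Adj v w).card < t))]
  · congr!
  intro t
  have h₁ := h.setReg (r := 12) (by omega) t
  refine Tests.ex h₁.stored.n_eq fun u => ?_
  have h₂ := h₁.setReg (r := 13) (by omega) u
  refine Tests.ex h₂.stored.n_eq fun v => ?_
  have h₃ := h₂.setReg (r := 14) (by omega) v
  refine ((tests_distinct (by simp) (by simp)).and (h₃.fuzzy (by simp) (by simp)).not).and
    ((Tests.lt _ _ _).congr ?_).not
  rw [Tests.eval_sum h₃.stored.n_eq (P := fun w => I.graph.fuzzy.Adj u w ∧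
    I.graph.fuzzy.Adj v w)]
  · simp only [Tm.eval, Memory.setReg_reg]
    congr!
  · intro w
    have h₄ := h₃.setReg (r := 15) (by omega) w
    exact (h₄.fuzzy (by simp) (by simp)).and (h₄.fuzzy (by simp) (by simp))

end

/-! ### The complete algorithm -/

/-- The budget is encoded in binary and may be far larger than `n`, too large for repeated addition.
Replacing it by its minimum with `n` does not alter a comparison with a number that is at most `n`.
-/
theorem le_bound_iff {a n k c : ℕ} (ha : a ≤ n) :
    a ≤ min k n * (min k n * (c * (c * 30))) ↔ a ≤ 30 * k ^ 2 * c ^ 2 := by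
  rcases le_total k n with hkn | hkn
  · rw [min_eq_left hkn, show k * (k * (c * (c * 30))) = 30 * k ^ 2 * c ^ 2 by ring]
  · rw [min_eq_right hkn]
    rcases Nat.eq_zero_or_pos c with rfl | hc
    · simp
    have h1 : n ≤ n * (n * (c * (c * 30))) := by
      rcases Nat.eq_zero_or_pos n with rfl | hn
      · simp
      · exact Nat.le_mul_of_pos_right n (by positivity)
    have h2 : n * (n * (c * (c * 30))) ≤ 30 * k ^ 2 * c ^ 2 := by
      calc n * (n * (c * (c * 30))) ≤ k * (k * (c * (c * 30))) := by gcongr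
        _ = _ := by ring
    exact ⟨fun _ => ha.trans (h1.trans h2), fun _ => ha.trans h1⟩

namespace Stmt

theorem run_seq (p q : Stmt) (s : Memory) : (seq p q).run s = q.run (p.run s) := rfl

theorem run_assign (r : ℕ) (t : Tm) (s : Memory) : (assign r t).run s = s.setReg r (t.eval s) := rfl

theorem run_cond (b : Tm) (p q : Stmt) (s : Memory) :
    (cond b p q).run s = if b.eval s ≠ 0 then p.run s else q.run s := rfl

end Stmt

theorem run_kernelize {I : CCInstance} {s : Memory} (h : Holds I Finset.univ s) :
    ∃ (S : Finset (Fin I.n)), (I.YesOn S ↔ I.IsYes) ∧ (∀ v, ¬ I.Redundant S v) ∧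
      ((I.core S).card ≤ 30 * I.k ^ 2 * I.fuzzyClosure ^ 2 →
        Output (I.induce (I.core S)) (Stmt.kernelize.run s)) ∧
      (¬ (I.core S).card ≤ 30 * I.k ^ 2 * I.fuzzyClosure ^ 2 →
        Output CCInstance.path (Stmt.kernelize.run s)) := by
  classical
  obtain ⟨S, h₁, hyes, hred⟩ := run_removeAll h
  refine ⟨S, hyes.trans CCInstance.isYes_iff_yesOn.symm, hred, ?_⟩
  rw [Stmt.kernelize, Stmt.run_seq]
  generalize Stmt.removeAll.run s = s₁ at h₁
  obtain ⟨h₂, hsel⟩ := run_core h₁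
  rw [Stmt.run_seq]
  generalize Stmt.core.run s₁ = s₂ at h₂ hsel
  simp only [Stmt.run_seq, Stmt.run_assign, Stmt.run_cond]
  have e3 : (Tm.sum 12 (.get 6 (.reg 12))).eval s₂ = (I.core S).card := by
    rw [Tests.eval_sum h₂.stored.n_eq (P := fun v => v ∈ I.core S)]
    · simp
    · intro v
      have hsel' : HoldsPred 6 (fun x => x ∈ I.core S) (s₂.setReg 12 v) := hsel
      exact hsel'.tests (by simp)
  rw [e3]
  have h₃ := h₂.setReg (r := 3) (by omega) (I.core S).card
  rw [h₃.eval_closure]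
  have h₄ := h₃.setReg (r := 4) (by omega) I.fuzzyClosure
  have e5 : (Tm.sub (.reg 0) (.sub (.reg 0) (.reg 1))).eval
      ((s₂.setReg 3 (I.core S).card).setReg 4 I.fuzzyClosure) = min I.k I.n := by
    simp only [Tm.eval, h₄.stored.n_eq, h₄.stored.k_eq]
    omega
  rw [e5]
  have h₅ := h₄.setReg (r := 5) (by omega) (min I.k I.n)
  have hsel₅ : HoldsPred 6 (fun x => x ∈ I.core S) (((s₂.setReg 3 (I.core S).card).setReg 4
    I.fuzzyClosure).setReg 5 (min I.k I.n)) := hsel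
  have hn : s₂.reg 0 = I.n := h₂.stored.n_eq
  -- Thus no factor of the product is affected by the truncation at `n`.
  have hcn : I.fuzzyClosure ≤ I.n := by
    rw [CCInstance.fuzzyClosure_eq_card]
    exact (Finset.card_le_univ _).trans (Fintype.card_fin _).le
  have hAn : (I.core S).card ≤ I.n := (Finset.card_le_univ _).trans (Fintype.card_fin _).le
  have e6 : Tm.excess.eval (((s₂.setReg 3 (I.core S).card).setReg 4
      I.fuzzyClosure).setReg 5 (min I.k I.n)) = (I.core S).card -
      min I.k I.n * (min I.k I.n * (I.fuzzyClosure * (I.fuzzyClosure * 30))) := by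
    simp [Tm.excess, Tm.eval, hn, hcn]
  rw [e6]
  have hready : Ready I (I.core S) (((s₂.setReg 3 (I.core S).card).setReg 4
    I.fuzzyClosure).setReg 5 (min I.k I.n)) := ⟨h₅.stored, hsel₅, by simp⟩
  rw [← le_bound_iff hAn]
  constructor <;> intro hle
  · rw [if_neg (not_not.mpr (Nat.sub_eq_zero_of_le hle))]
    exact run_outputInduced hready
  · rw [if_pos (Nat.sub_ne_zero_of_lt (not_le.mp hle))]
    exact run_outputPath _

theorem below_kernelize : Stmt.kernelize.Below 20 := by
  have hw : ∀ a f, (Stmt.write a f 9).Below 20 := fun a f => Stmt.below_write a f 9 (by omega)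
  simp [Stmt.kernelize, Stmt.removeAll, Stmt.removeOne, Stmt.core, Stmt.reach, Stmt.outputPath,
    Stmt.outputInduced, Stmt.extract, Stmt.copy, Stmt.fillMatrix, Stmt.fill, Stmt.skip, Stmt.Below,
    Tm.redundant, Tm.core, Tm.step, Tm.nonedge, Tm.distinct, Tm.alive, Tm.cell, Tm.addr, Tm.rank,
    Tm.excess, Tm.closure, Tm.and, Tm.or, Tm.not, Tm.imp, Tm.ex, Tm.all, Tm.lt, Tm.eq, Tm.Below, hw]

/-- The kernelization. -/
def kernelization : Program :=
  .seq (Stmt.kernelize.compile 20) (.seq (.assign 1 (.reg 6)) (.assign 0 (.reg 3)))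

/-- Register `0` bounds all loops and is never written by a statement, so the new `n` and `k` are
moved into place only at the very end. -/
theorem runs_kernelization {J : CCInstance} {s : Memory}
    (h : Output J (Stmt.kernelize.run s)) :
    Runs kernelization s ((Stmt.kernelize.time + 4).eval (s.reg 0)) J.StoredIn := by
  have hrun := Stmt.runs_compile below_kernelize (by omega) le_rfl (s := s) (s₀ := s)
    ⟨rfl, fun _ _ => rfl⟩
  refine Runs.mono (Runs.seq (hrun.mono le_rfl fun s₁ h₁ => Runs.seq
    (Runs.assign (Runs.assign (Q := J.StoredIn) ?_)))) (by simp [Expr.cost]) fun _ => id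
  obtain ⟨⟨ha, hr⟩, -⟩ := h₁
  refine h _ ha ?_ ?_
  · simp [Expr.eval, hr 3 (by omega)]
  · simp [Expr.eval, hr 6 (by omega)]

theorem holds_univ_of_initialMemory {I : CCInstance} {s : Memory} (h : I.InitialMemory s) :
    Holds I Finset.univ s where
  stored := h.toStoredIn
  removed x := ⟨fun hx => absurd (Finset.mem_univ x) hx,
    fun _ => h.arr_eq_zero 3 x (Or.inl le_rfl)⟩

open Polynomial in
/-- A bound for the size of an instance with at most `30 * X ^ 4 + 3` vertices, and for its
parameters. -/
noncomputable def sizeBound : Polynomial ℕ :=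
  (30 * X ^ 4 + 3) ^ 2 + (30 * X ^ 4 + 3) + X + (30 * X ^ 4 + 3) ^ 2 * (X + 1) + X

theorem le_eval_sizeBound {n k m q sz kc : ℕ} (hsz : sz ≤ n ^ 2 + n + k + n ^ 2 * m)
    (hn : n ≤ 30 * q ^ 4 + 3) (hk : k ≤ q) (hm : m ≤ q + 1) (hkc : kc ≤ q) :
    sz + kc ≤ sizeBound.eval q := by
  have : sizeBound.eval q = (30 * q ^ 4 + 3) ^ 2 + (30 * q ^ 4 + 3) + q +
      (30 * q ^ 4 + 3) ^ 2 * (q + 1) + q := by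
    simp [sizeBound]
  rw [this]
  refine Nat.add_le_add (hsz.trans ?_) hkc
  gcongr

theorem nat_le_size (I : CCInstance) : I.n ≤ I.size := by
  have : I.n ≤ I.n ^ 2 := Nat.le_self_pow two_ne_zero _
  rw [CCInstance.size]
  omega

end CorrelationClustering

open CorrelationClustering
theorem theorem2 :
    ∃ (p : Program) (T S : Polynomial ℕ), ∀ (I : CCInstance) (s : Memory), I.InitialMemory s →
      ∃ (I' : CCInstance) (s' : Memory) (t : ℕ),
        -- `p` computes `I'` from `I` in polynomial time,
        Exec p s s' t ∧ I'.StoredIn s' ∧ t ≤ T.eval I.size ∧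
        -- the two instances are equivalent,
        (I.IsYes ↔ I'.IsYes) ∧
        -- size and parameter of `I'` are polynomial in the parameter `k + c` of `I`,
        I'.size + (I'.k + I'.fuzzyClosure) ≤ S.eval (I.k + I.fuzzyClosure) ∧
        -- neither `k` nor `c` increases,
        I'.k ≤ I.k ∧ I'.fuzzyClosure ≤ I.fuzzyClosure ∧
        -- and the number of vertices is bounded.
        (1 ≤ I.k → I'.n ≤ 30 * I.k ^ 2 * I.fuzzyClosure ^ 2) ∧
        (I.k = 0 → I'.n ≤ 3) := by
  refine ⟨kernelization, Stmt.kernelize.time + 4, sizeBound, fun I s hs => ?_⟩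
  obtain ⟨S, hyes, hred, hind, hpath⟩ := run_kernelize (holds_univ_of_initialMemory hs)
  have htime : (Stmt.kernelize.time + 4).eval (s.reg 0) ≤
      (Stmt.kernelize.time + 4).eval I.size := by
    rw [hs.n_eq]
    exact eval_mono _ (nat_le_size I)
  by_cases hle : (I.core S).card ≤ 30 * I.k ^ 2 * I.fuzzyClosure ^ 2
  · obtain ⟨s', t, h1, h2, h3⟩ := runs_kernelization (hind hle)
    have hc := CCInstance.fuzzyClosure_induce_le (I.core S)
    refine ⟨I.induce (I.core S), s', t, h1, h3, h2.trans htime, ?_, ?_, le_rfl, hc,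
      fun _ => hle, fun hk => ?_⟩
    · rw [CCInstance.isYes_induce_iff, CCInstance.yesOn_core_iff, hyes]
    · refine le_eval_sizeBound (m := I.k + 1)
        ((I.induce (I.core S)).size_le_of_weight_le fun e => min_le_right _ _)
        (hle.trans ?_) (Nat.le_add_right _ _) (by omega) (Nat.add_le_add le_rfl hc)
      calc 30 * I.k ^ 2 * I.fuzzyClosure ^ 2
          ≤ 30 * (I.k + I.fuzzyClosure) ^ 2 * (I.k + I.fuzzyClosure) ^ 2 := by
            gcongr <;> omega
        _ = 30 * (I.k + I.fuzzyClosure) ^ 4 := by ring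
        _ ≤ _ := Nat.le_add_right _ _
    · have : (I.core S).card ≤ 0 := by simpa [hk] using hle
      exact this.trans (Nat.zero_le _)
  · obtain ⟨s', t, h1, h2, h3⟩ := runs_kernelization (hpath hle)
    -- An oversized core is nonempty, hence contains an end of a real edge. Positivity of `c` gives
    -- both `c' ≤ c` for the path and `3 ≤ 30k²c²` when `k` is positive.
    have hpos : 0 < I.fuzzyClosure := by
      obtain ⟨v, hv⟩ : (I.core S).Nonempty := Finset.card_pos.mp (by omega)
      obtain ⟨u, -, huv⟩ := CCInstance.exists_real_of_mem_core hv
      exact CCInstance.fuzzyClosure_pos_of_not_fuzzy (CCInstance.not_fuzzy_of_real huv) huv.ne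
    have hc : CCInstance.path.fuzzyClosure ≤ I.fuzzyClosure :=
      CCInstance.fuzzyClosure_path_le.trans hpos
    refine ⟨CCInstance.path, s', t, h1, h3, h2.trans htime, ?_, ?_, Nat.zero_le _, hc,
      fun hk => ?_, fun _ => le_rfl⟩
    · refine iff_of_false (fun h => hle ?_) CCInstance.not_isYes_path
      exact CCInstance.card_core_le (hyes.mpr h) hred (isClosedGraph_graphClosure _)
    · refine le_eval_sizeBound (n := 3) (k := 0) (m := 1)
        (CCInstance.path.size_le_of_weight_le fun e => ?_)
        (Nat.le_add_left _ _) (Nat.zero_le _) (Nat.le_add_left _ _) ?_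
      · change (if e.IsDiag then 0 else 1) ≤ 1
        split_ifs <;> omega
      · change 0 + CCInstance.path.fuzzyClosure ≤ _
        omega
    · have : 1 ≤ I.k ^ 2 * I.fuzzyClosure ^ 2 :=
        Nat.mul_pos (Nat.pow_pos hk) (Nat.pow_pos hpos)
      change 3 ≤ _
      rw [mul_assoc]
      omega
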